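/- Natural numbers are positive. Put $\zeta_n=e^{2\pi i/n}$, $K_n=\mathbb{Q}(\zeta_n)$, $k_n=\mathbb{Q}(\zeta_n+\bar\zeta_n)$, $\mathcal{O}_n=\mathbb{Z}[\zeta_n]$ and $o_n=\mathbb{Z}[\zeta_n+\bar\zeta_n]$, all inside $\mathbb{C}=\mathbb{R}^2$. Let $n\ge 3$. A *cyclotomic model set with underlying $\mathbb{Z}$-module $\mathcal{O}_n$* is a set of the form $\Lambda=t+\{z\in\mathcal{O}_n : (\sigma_2(z),\dots,\sigma_{\phi(n)/2}(z))\in W\}$, where $t\in\mathbb{C}$, the set $\{\sigma_2,\dots,\sigma_{\phi(n)/2}\}$ contains exactly one automorphism from each pair of complex conjugate automorphisms in $\mathrm{Gal}(K_n/\mathbb{Q})\setminus\{\mathrm{id},\bar{\,\cdot\,}\}$, and $W\subset(\mathbb{R}^2)^{\phi(n)/2-1}$ has non-empty interior and compact closure. Let $K_\Lambda$ be the subfield of $\mathbb{C}$ generated over $\mathbb{Q}$ by $\Lambda-\Lambda$ and its complex conjugate, and let $k_\Lambda=K_\Lambda\cap\mathbb{R}$. A $\Lambda$-direction is a unit vector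 parallel to a non-zero element of $\Lambda-\Lambda$. A polygon is a non-degenerate convex polygon; it is a polygon *in* $\Lambda$ if all its vertices lie in $\Lambda$, and it is *affinely regular* if it is the image of a regular polygon under a non-singular affine transformation of the plane. For a finite set $U$ of pairwise non-parallel unit vectors, a polygon $P$ is a *$U$-polygon* if, for every vertex $v$ of $P$ and every $u\in U$, the line through $v$ in direction $u$ meets another vertex of $P$. A $U$-polygon is of *class* $c$ with respect to $U$ if $c$ is the largest integer with $0<c\le\operatorname{card}(U)$ such that $P$ has $c$ consecutive edges all of which are parallel to elements of $U$. **Corollary.** Let $m,n\in\mathbb{N}$ with $m\ge 8$ even and $n\ge 3$, and let $\Lambda$ be a cyclotomic model set with underlying $\mathbb{Z}$-module $\mathcal{O}_n$. The following statements are equivalent: (i) There is a $U$-polygon of class $c\ge 4$ in $\Lambda$ with $m$ edges (for some $U$). (ii) There is an affinely regular $U$-polygon of class $c\ge 4$ with $m$ edges for some set $U$ of $\Lambda$-directions. (iii) $k_{m/2}\subset k_\Lambda$. (iv) There is an affinely regular polygon in $\Lambda$ with $\operatorname{lcm}(m/2,2)$ edges. (v) $k_{m/2}\subset k_n$. (vi)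 $m\in\{8,12\}$, or $K_{m/2}\subset K_n$. (vii) $m\in\{8,12\}$, or $m\mid 2n$, or $m=4d$ with $d$ an odd divisor of $n$. (viii) $m\in\{8,12\}$, or $\mathcal{O}_{m/2}\subset\mathcal{O}_n$. (ix) $o_{m/2}\subset o_n$. -/

import Mathlib

open scoped ComplexConjugate Pointwise

namespace UPoly

noncomputable section

/-! ### Cyclotomic fields and rings inside the complex numbers -/

/-- The primitive root of unity `ζ_n = exp (2πi / n)`. -/
def zeta (n : ℕ) : ℂ := Complex.exp (2 * Real.pi * Complex.I / n)

/-- `K_n = ℚ(ζ_n)`. -/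
def K (n : ℕ) : IntermediateField ℚ ℂ := IntermediateField.adjoin ℚ {zeta n}

/-- `k_n = ℚ(ζ_n + conj ζ_n)`. -/
def k (n : ℕ) : IntermediateField ℚ ℂ := IntermediateField.adjoin ℚ {zeta n + conj (zeta n)}

/-- `O_n = ℤ[ζ_n]`. -/
def O (n : ℕ) : Subalgebra ℤ ℂ := Algebra.adjoin ℤ {zeta n}

/-- `o_n = ℤ[ζ_n + conj ζ_n]`. -/
def o (n : ℕ) : Subalgebra ℤ ℂ := Algebra.adjoin ℤ {zeta n + conj (zeta n)}

/-- The real numbers, as a subfield of `ℂ`. -/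
def reals : IntermediateField ℚ ℂ := (Complex.ofRealHom.toRatAlgHom).fieldRange

/-- `K_Λ = ℚ((Λ - Λ) ∪ conj (Λ - Λ))`. -/
def KSet (Λ : Set ℂ) : IntermediateField ℚ ℂ :=
  IntermediateField.adjoin ℚ ((Λ - Λ) ∪ (fun z : ℂ => conj z) '' (Λ - Λ))

/-- `k_Λ = K_Λ ∩ ℝ`. -/
def kSet (Λ : Set ℂ) : IntermediateField ℚ ℂ := KSet Λ ⊓ reals

/-! ### Cyclotomic model sets -/

/-- The automorphisms `σ` and `τ` of `K_n` are complex conjugates of each other. -/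
def ConjugateAut {n : ℕ} (σ τ : K n ≃ₐ[ℚ] K n) : Prop :=
  ∀ z : K n, ((τ z : K n) : ℂ) = conj ((σ z : K n) : ℂ)

/-- The family `σ` consists of exactly one automorphism from each pair of complex conjugate
elements of `Gal(K_n / ℚ)` other than the pair formed by the identity and complex conjugation. -/
def IsStarFamily (n : ℕ) (σ : Fin (Nat.totient n / 2 - 1) → (K n ≃ₐ[ℚ] K n)) : Prop :=
  (∀ i, σ i ≠ 1 ∧ ¬ ConjugateAut 1 (σ i)) ∧
  ∀ τ : K n ≃ₐ[ℚ] K n, τ ≠ 1 → ¬ ConjugateAut 1 τ →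
    ∃! i, σ i = τ ∨ ConjugateAut τ (σ i)

/-- `Λ` is a cyclotomic model set with underlying `ℤ`-module `O_n`: a translate of the set of
all `z ∈ O_n` whose star image lies in a window `W` with non-empty interior and compact closure. -/
def IsCyclotomicModelSet (n : ℕ) (Λ : Set ℂ) : Prop :=
  ∃ σ : Fin (Nat.totient n / 2 - 1) → (K n ≃ₐ[ℚ] K n), IsStarFamily n σ ∧
    ∃ W : Set (Fin (Nat.totient n / 2 - 1) → ℂ),
      (interior W).Nonempty ∧ IsCompact (closure W) ∧
      ∃ t : ℂ, Λ = {x : ℂ | ∃ z : K n, (z : ℂ) ∈ O n ∧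
        (fun i => ((σ i z : K n) : ℂ)) ∈ W ∧ x = (z : ℂ) + t}

/-! ### Polygons and directions -/

/-- Two non-zero vectors of the plane are parallel. -/
def Parallel (a b : ℂ) : Prop := ∃ r : ℝ, r ≠ 0 ∧ b = (r : ℂ) * a

/-- The line through `p` in direction `u`. -/
def lineThrough (u p : ℂ) : Set ℂ := {z : ℂ | ∃ t : ℝ, z = p + (t : ℂ) * u}

/-- `v` lists the vertices of a non-degenerate convex polygon with exactly `m` vertices (and so
`m` edges) in counterclockwise order: for each edge, from `v i` to `v (i + 1)`, all the other
vertices lie strictly to its left.  (`Im (conj a * b)` is the determinant of `(a, b)`.) -/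
def IsConvexPolygon {m : ℕ} (v : ZMod m → ℂ) : Prop :=
  3 ≤ m ∧ ∀ i j : ZMod m, j ≠ i → j ≠ i + 1 →
    0 < (conj (v (i + 1) - v i) * (v j - v i)).im

/-- A polygon in `S` is a convex polygon all of whose vertices belong to `S`. -/
def PolygonIn {m : ℕ} (S : Set ℂ) (v : ZMod m → ℂ) : Prop :=
  IsConvexPolygon v ∧ ∀ i, v i ∈ S

/-- A convex polygon is affinely regular if it is the image of a regular polygon under a
non-singular affine transformation of the real plane.  Every regular `m`-gon is similar to the
one formed by the `m`-th roots of unity.  (As `v` is listed counterclockwise, a transformation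
that reverses orientation is to be composed first with complex conjugation.) -/
def IsAffinelyRegular {m : ℕ} (v : ZMod m → ℂ) : Prop :=
  IsConvexPolygon v ∧ ∃ ψ : ℂ ≃ᵃ[ℝ] ℂ, ∀ i : ZMod m, v i = ψ (zeta m ^ i.val)

/-- A finite set of pairwise non-parallel directions (elements of the unit circle). -/
def IsDirectionSet (U : Finset ℂ) : Prop :=
  (∀ u ∈ U, ‖u‖ = 1) ∧ ∀ u ∈ U, ∀ w ∈ U, u ≠ w → ¬ Parallel u w

/-- `u` is a `Λ`-direction: a unit vector parallel to a non-zero element of `Λ - Λ`. -/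
def IsLambdaDirection (Λ : Set ℂ) (u : ℂ) : Prop :=
  ‖u‖ = 1 ∧ ∃ d ∈ Λ - Λ, d ≠ 0 ∧ Parallel u d

/-- `U`-polygon: for each vertex and each direction in `U`, the line through that vertex in that
direction meets another vertex. -/
def IsUPolygon {m : ℕ} (U : Finset ℂ) (v : ZMod m → ℂ) : Prop :=
  IsDirectionSet U ∧ IsConvexPolygon v ∧
    ∀ i : ZMod m, ∀ u ∈ U, ∃ j : ZMod m, j ≠ i ∧ v j ∈ lineThrough u (v i)

/-- There are `c` consecutive edges of the polygon whose directions belong to `U`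
(up to sign, as an edge has no orientation). -/
def HasConsecutive {m : ℕ} (U : Finset ℂ) (v : ZMod m → ℂ) (c : ℕ) : Prop :=
  ∃ i : ZMod m, ∀ j : ℕ, j < c →
    ∃ u ∈ U, Parallel u (v (i + (j : ZMod m) + 1) - v (i + (j : ZMod m)))

/-- The polygon `v` has class `c` with respect to `U`: among the integers `c` with
`0 < c ≤ card U`, it is the largest number of consecutive edges whose directions belong to `U`. -/
def HasClass {m : ℕ} (U : Finset ℂ) (v : ZMod m → ℂ) (c : ℕ) : Prop :=
  IsGreatest {c : ℕ | 0 < c ∧ c ≤ U.card ∧ HasConsecutive U v c} c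

end

end UPoly

namespace UPoly

/-! ### Cyclotomic fields and their real subfields -/

/-! Write m = 2N with N ≥ 4. Everything is compared with (v), k_N ⊂ k_n. It agrees with (iii)
because Λ contains a homothetic copy of every finite subset of K_n, whence K_Λ = K_n and k_Λ = K_n ∩
ℝ = k_n (`IsCyclotomicModelSet.exists_homothety`, `K_inf_reals`). The copies come from a positive
real μ ∈ O_n whose other conjugates are small: multiplying by μ^k is a homothety of the plane that
shrinks star images, and a suitable translation then brings them into the window.

From polygons to fields. In a U-polygon, the chords parallel to an edge with direction in U pair the
vertices symmetrically about that edge (`IsConvexPolygon.cross_eq_of_add_eq`). Four consecutive such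
edges force every other vertex to obey D(i+2) = tD(i+1) − D(i) for edge vectors D
(`exists_recurrence`). Closing up after exactly N steps makes t = ρ + ρ⁻¹ with ρ a primitive N-th
root of unity, while t is a ratio of parallel vectors of K_Λ; so k_N ⊂ k_Λ. For affinely regular
polygons, a ratio of parallel chords, or an invariant of four edge directions, gives the trace.

From fields to polygons. If k_N ⊂ k_n, the real-linear map fixing 1 and sending ζ_N to ζ_n carries
K_N = k_N + k_N ζ_N into K_n (`exists_linear_map_K`). It is applied to a regular N-gon together with
a rotated copy whose vertices also lie in K_N, which gives (i), and to a regular lcm(N,2)-gon, which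
gives (iv). For (ii) a regular 2N-gon is used; only its edge directions need to come from K_N.

Arithmetic. When k_N ⊂ k_n, either gcd(N, n) ≥ 3, and a common non-real root of unity gives K_N ⊂
K_n, or a degree count gives φ(N) ≤ 2, so N is 4 or 6 and k_N = ℚ (`K_le_of_k_le`). The roots of
unity in K_n, namely ±ζ_n^r, settle divisibility and the statements about rings. -/

theorem isPrimitiveRoot_zeta {n : ℕ} (hn : n ≠ 0) : IsPrimitiveRoot (zeta n) n :=
  Complex.isPrimitiveRoot_exp n hn

theorem zeta_mem_K (n : ℕ) : zeta n ∈ K n :=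
  IntermediateField.mem_adjoin_simple_self ℚ _

theorem zeta_eq_exp (n : ℕ) : zeta n = Complex.exp ((2 * Real.pi / n : ℝ) * Complex.I) := by
  unfold zeta; congr 1; push_cast; ring

theorem conj_zeta (n : ℕ) : conj (zeta n) = (zeta n)⁻¹ := by
  rw [zeta_eq_exp, ← Complex.exp_conj, ← Complex.exp_neg]
  congr 1
  simp only [map_mul, Complex.conj_ofReal, Complex.conj_I]; ring

theorem zeta_ne_zero (n : ℕ) : zeta n ≠ 0 := Complex.exp_ne_zero _

theorem zeta_re (n : ℕ) : (zeta n).re = Real.cos (2 * Real.pi / n) := by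
  rw [zeta_eq_exp, Complex.exp_ofReal_mul_I_re]

theorem zeta_im (n : ℕ) : (zeta n).im = Real.sin (2 * Real.pi / n) := by
  rw [zeta_eq_exp, Complex.exp_ofReal_mul_I_im]

theorem zeta_im_pos {n : ℕ} (hn : 3 ≤ n) : 0 < (zeta n).im := by
  rw [zeta_im]
  have h3 : (3 : ℝ) ≤ n := by exact_mod_cast hn
  apply Real.sin_pos_of_pos_of_lt_pi
  · positivity
  · rw [div_lt_iff₀ (by linarith)]
    nlinarith [Real.pi_pos]

theorem conj_ne_of_im_pos {z : ℂ} (h : 0 < z.im) : conj z ≠ z := by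
  intro e
  have := Complex.conj_eq_iff_im.1 e
  linarith

theorem mem_reals {z : ℂ} : z ∈ reals ↔ conj z = z := by
  rw [Complex.conj_eq_iff_real]
  constructor
  · rintro ⟨r, hr⟩; exact ⟨r, hr.symm⟩
  · rintro ⟨r, hr⟩; exact ⟨r, hr.symm⟩

theorem conj_mem_adjoin {S : Set ℂ} (hS : ∀ z ∈ S, conj z ∈ IntermediateField.adjoin ℚ S)
    {z : ℂ} (hz : z ∈ IntermediateField.adjoin ℚ S) :
    conj z ∈ IntermediateField.adjoin ℚ S := by
  have h : IntermediateField.adjoin ℚ S ≤ (IntermediateField.adjoin ℚ S).comap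
      (Complex.conjAe.restrictScalars ℚ : ℂ ≃ₐ[ℚ] ℂ).toAlgHom :=
    IntermediateField.adjoin_le_iff.2 fun z hz => hS z hz
  exact h hz

theorem conj_mem_K {n : ℕ} {z : ℂ} (hz : z ∈ K n) : conj z ∈ K n := by
  refine conj_mem_adjoin (fun w hw => ?_) hz
  rw [Set.mem_singleton_iff.1 hw, conj_zeta]
  exact inv_mem (zeta_mem_K n)

theorem conj_mem_KSet {Λ : Set ℂ} {z : ℂ} (hz : z ∈ KSet Λ) : conj z ∈ KSet Λ := by
  refine conj_mem_adjoin (fun w hw => ?_) hz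
  apply IntermediateField.subset_adjoin
  rcases hw with hw | ⟨x, hx, rfl⟩
  · exact Or.inr ⟨w, hw, rfl⟩
  · left; simpa using hx

theorem k_le_K (n : ℕ) : k n ≤ K n := by
  refine IntermediateField.adjoin_le_iff.2 ?_
  rintro _ rfl
  exact add_mem (zeta_mem_K n) (conj_mem_K (zeta_mem_K n))

theorem k_le_reals (n : ℕ) : k n ≤ reals := by
  refine IntermediateField.adjoin_le_iff.2 ?_
  rintro _ rfl
  refine mem_reals.2 ?_
  simp [add_comm]

theorem trace_mem_k (n : ℕ) : zeta n + conj (zeta n) ∈ k n :=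
  IntermediateField.mem_adjoin_simple_self ℚ _

/-- The quadratic equation X² − (ζ + ζ⁻¹)X + 1 = 0 of ζ over k_n. It reduces products in the
coordinates 1, ζ, and bounds the degree of ζ over any field containing its trace. -/
theorem zeta_sq (n : ℕ) : zeta n * zeta n = (zeta n + conj (zeta n)) * zeta n - 1 := by
  rw [conj_zeta]
  field_simp [zeta_ne_zero n]
  ring

theorem toSubalgebra_K {n : ℕ} (hn : n ≠ 0) :
    (K n).toSubalgebra = Algebra.adjoin ℚ {zeta n} :=
  IntermediateField.adjoin_simple_toSubalgebra_of_isAlgebraic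
    (IsIntegral.isAlgebraic ((isPrimitiveRoot_zeta hn).isIntegral hn.bot_lt).tower_top)

theorem exists_eq_add_mul_zeta {n : ℕ} (hn : n ≠ 0) {z : ℂ} (hz : z ∈ K n) :
    ∃ a ∈ k n, ∃ b ∈ k n, z = a + b * zeta n := by
  rw [← IntermediateField.mem_toSubalgebra, toSubalgebra_K hn] at hz
  induction hz using Algebra.adjoin_induction with
  | mem x hx => exact ⟨0, zero_mem _, 1, one_mem _, by rw [Set.mem_singleton_iff.1 hx]; ring⟩
  | algebraMap r => exact ⟨algebraMap ℚ ℂ r, algebraMap_mem _ r, 0, zero_mem _, by ring⟩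
  | add x y _ _ hx hy =>
    obtain ⟨a, ha, b, hb, rfl⟩ := hx
    obtain ⟨c, hc, d, hd, rfl⟩ := hy
    exact ⟨a + c, add_mem ha hc, b + d, add_mem hb hd, by ring⟩
  | mul x y _ _ hx hy =>
    obtain ⟨a, ha, b, hb, rfl⟩ := hx
    obtain ⟨c, hc, d, hd, rfl⟩ := hy
    refine ⟨a * c - b * d, sub_mem (mul_mem ha hc) (mul_mem hb hd),
      a * d + b * c + b * d * (zeta n + conj (zeta n)),
      add_mem (add_mem (mul_mem ha hd) (mul_mem hb hc)) (mul_mem (mul_mem hb hd) (trace_mem_k n)),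
      ?_⟩
    linear_combination b * d * zeta_sq n

/-- In a subfield of `ℂ` that is closed under conjugation, every element is a combination of `1`
and a given non-real element, with real coefficients from the subfield. -/
theorem exists_real_coordinates {F : IntermediateField ℚ ℂ} (hF : ∀ z ∈ F, conj z ∈ F) {x y : ℂ}
    (hx : x ∈ F) (hy : y ∈ F) (hy' : conj y ≠ y) :
    ∃ a ∈ F ⊓ reals, ∃ b ∈ F ⊓ reals, x = a + b * y := by
  have h0 : y - conj y ≠ 0 := sub_ne_zero.2 hy'.symm
  have h0' : conj y - y ≠ 0 := sub_ne_zero.2 hy'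
  have hb : (x - conj x) / (y - conj y) ∈ F ⊓ reals := by
    refine ⟨div_mem (sub_mem hx (hF x hx)) (sub_mem hy (hF y hy)), mem_reals.2 ?_⟩
    simp only [map_div₀, map_sub, Complex.conj_conj]
    rw [← neg_sub x, ← neg_sub y, neg_div_neg_eq]
  refine ⟨x - (x - conj x) / (y - conj y) * y,
    ⟨sub_mem hx (mul_mem hb.1 hy), mem_reals.2 ?_⟩, _, hb, by ring⟩
  rw [map_sub, map_mul, mem_reals.1 hb.2]
  field_simp
  ring

/-- In z = a + bζ with a, b real, the number z is real only if b = 0, as ζ is not. -/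
theorem K_inf_reals {n : ℕ} (hn : 3 ≤ n) : K n ⊓ reals = k n := by
  refine le_antisymm ?_ (le_inf (k_le_K n) (k_le_reals n))
  rintro z ⟨hz, hr⟩
  obtain ⟨a, ha, b, hb, rfl⟩ := exists_eq_add_mul_zeta (by omega) hz
  have h1 := mem_reals.1 hr
  rw [map_add, map_mul, mem_reals.1 (k_le_reals n ha), mem_reals.1 (k_le_reals n hb)] at h1
  have h2 : b * (conj (zeta n) - zeta n) = 0 := by linear_combination h1
  rcases mul_eq_zero.1 h2 with h | h
  · simpa [h] using ha
  · exact absurd (sub_eq_zero.1 h) (conj_ne_of_im_pos (zeta_im_pos hn))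

theorem k_le_of_K_le {N n : ℕ} (hn : 3 ≤ n) (h : K N ≤ K n) : k N ≤ k n := by
  rw [← K_inf_reals hn]
  exact le_inf ((k_le_K N).trans h) (k_le_reals N)

theorem K_le_iff {N n : ℕ} : K N ≤ K n ↔ zeta N ∈ K n := by
  simp [K, IntermediateField.adjoin_le_iff]

theorem zeta_pow_mul {a b : ℕ} (ha : a ≠ 0) : zeta (a * b) ^ a = zeta b := by
  have ha' : (a : ℂ) ≠ 0 := by exact_mod_cast ha
  rw [zeta, zeta, ← Complex.exp_nat_mul]
  congr 1
  push_cast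
  field_simp

theorem zeta_mem_of_dvd {N n : ℕ} (hn : n ≠ 0) (h : N ∣ n) : ∃ r : ℕ, zeta N = zeta n ^ r := by
  obtain ⟨d, rfl⟩ := h
  refine ⟨d, ?_⟩
  rw [mul_comm, zeta_pow_mul]
  rintro rfl; simp at hn

/-- From ζ_{2d}^d = −1 follows ζ_{2d}^{d+1} = −ζ_{2d}; the exponent d + 1 is even and ζ_{2d}² = ζ_d.
-/
theorem zeta_two_mul_odd {d : ℕ} (hd : Odd d) : zeta (2 * d) = -zeta d ^ ((d + 1) / 2) := by
  obtain ⟨e, rfl⟩ := hd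
  have h1 : (2 * e + 1 + 1) / 2 = e + 1 := by omega
  rw [h1, ← zeta_pow_mul (a := 2) (b := 2 * e + 1) (by norm_num), ← pow_mul]
  have h2 : zeta (2 * (2 * e + 1)) ^ (2 * e + 1) = -1 := by
    rw [mul_comm 2 (2 * e + 1), zeta_pow_mul (by omega)]
    simp only [zeta]
    push_cast
    rw [show 2 * (Real.pi : ℂ) * Complex.I / 2 = Real.pi * Complex.I by ring, Complex.exp_pi_mul_I]
  rw [show 2 * (e + 1) = (2 * e + 1) + 1 by ring, pow_succ, h2]
  ring

/-! ### Roots of unity in K_n -/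

instance isCyclotomicExtension_K {n : ℕ} [NeZero n] : IsCyclotomicExtension {n} ℚ (K n) := by
  change IsCyclotomicExtension {n} ℚ (K n).toSubalgebra
  rw [toSubalgebra_K (NeZero.ne n)]
  exact (isPrimitiveRoot_zeta (NeZero.ne n)).adjoin_isCyclotomicExtension ℚ

instance numberField_K {n : ℕ} [NeZero n] : NumberField (K n) :=
  IsCyclotomicExtension.numberField {n} ℚ (K n)

/-- `ζ_n` as an element of `K_n`. -/
noncomputable def zetaK (n : ℕ) : K n := ⟨zeta n, zeta_mem_K n⟩

theorem isPrimitiveRoot_zetaK {n : ℕ} (hn : n ≠ 0) : IsPrimitiveRoot (zetaK n) n :=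
  IsPrimitiveRoot.coe_submonoidClass_iff.1 (isPrimitiveRoot_zeta hn)

/-- The roots of unity of `K_n` are, up to sign, powers of `ζ_n`. -/
theorem eq_pow_or_eq_neg_pow {N n : ℕ} (hN : N ≠ 0) (hn : n ≠ 0) (h : zeta N ∈ K n) :
    (∃ r : ℕ, zeta N = zeta n ^ r) ∨ (Odd n ∧ ∃ r : ℕ, zeta N = -zeta n ^ r) := by
  have : NeZero n := ⟨hn⟩
  have hp : IsPrimitiveRoot (⟨zeta N, h⟩ : K n) N :=
    IsPrimitiveRoot.coe_submonoidClass_iff.1 (isPrimitiveRoot_zeta hN)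
  have hdvd := hp.dvd_of_isCyclotomicExtension n hN
  rcases Nat.even_or_odd n with he | ho
  · left
    have hroot := isPrimitiveRoot_zetaK hn
    -- for even `n`, the orders of `ζ_N` and `ζ_n` have least common multiple `n`
    have key := hp.lcm_totient_le_finrank hroot
      (Polynomial.cyclotomic.irreducible_rat <| Nat.lcm_pos hN.bot_lt hn.bot_lt)
    rw [IsCyclotomicExtension.finrank (n := n) (K n)
      (Polynomial.cyclotomic.irreducible_rat hn.bot_lt)] at key
    obtain ⟨r, hr⟩ := Nat.dvd_lcm_right N n
    have hr0 : r ≠ 0 := by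
      rintro rfl
      exact Nat.lcm_ne_zero hN hn (by simpa using hr)
    have hr2 : r ∣ 2 := by
      have h2 : N.lcm n ∣ n * 2 := Nat.lcm_dvd (by rwa [mul_comm]) (dvd_mul_right n 2)
      rw [hr] at h2
      exact Nat.dvd_of_mul_dvd_mul_left hn.bot_lt h2
    rcases (Nat.dvd_prime Nat.prime_two).1 hr2 with h1 | h2
    · rw [h1, mul_one] at hr
      exact zeta_mem_of_dvd hn (hr ▸ Nat.dvd_lcm_left N n)
    -- Here the least common multiple is 2n, and for even n one has φ(2n) = 2φ(n), more than the
    -- degree of K_n.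
    · exfalso
      rw [hr, h2, mul_comm, Nat.totient_mul_of_prime_of_dvd Nat.prime_two he.two_dvd] at key
      have := Nat.totient_pos.2 hn.bot_lt
      omega
  · obtain ⟨r, hr, h1 | h1⟩ := (isPrimitiveRoot_zetaK hn).exists_pow_or_neg_mul_pow_of_isOfFinOrder
      ho (x := ⟨zeta N, h⟩) (isOfFinOrder_iff_pow_eq_one.2 ⟨N, hN.bot_lt, hp.pow_eq_one⟩)
    · exact Or.inl ⟨r, congrArg Subtype.val h1⟩
    · exact Or.inr ⟨ho, r, congrArg Subtype.val h1⟩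

theorem zeta_mem_K_iff {N n : ℕ} (hN : N ≠ 0) (hn : n ≠ 0) :
    zeta N ∈ K n ↔ N ∣ n ∨ ∃ d : ℕ, Odd d ∧ d ∣ n ∧ N = 2 * d := by
  constructor
  · intro h
    rcases eq_pow_or_eq_neg_pow hN hn h with ⟨r, hr⟩ | ⟨ho, r, hr⟩
    · left
      refine (isPrimitiveRoot_zeta hN).dvd_of_pow_eq_one n ?_
      rw [hr, ← pow_mul, mul_comm, pow_mul, (isPrimitiveRoot_zeta hn).pow_eq_one, one_pow]
    · have hd : N ∣ 2 * n := by
        refine (isPrimitiveRoot_zeta hN).dvd_of_pow_eq_one _ ?_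
        rw [hr, pow_mul, neg_sq, ← pow_mul, ← pow_mul, show r * (2 * n) = n * (r * 2) by ring,
          pow_mul, (isPrimitiveRoot_zeta hn).pow_eq_one, one_pow]
      rcases Nat.even_or_odd N with he | hoN
      · obtain ⟨d, rfl⟩ := he.two_dvd
        have hdn := Nat.dvd_of_mul_dvd_mul_left (by norm_num) hd
        exact Or.inr ⟨d, Odd.of_dvd_nat ho hdn, hdn, rfl⟩
      · exact Or.inl ((Nat.Coprime.dvd_mul_left hoN.coprime_two_right).1 hd)
  · rintro (h | ⟨d, hd, hdn, rfl⟩)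
    · obtain ⟨r, hr⟩ := zeta_mem_of_dvd hn h
      exact hr ▸ pow_mem (zeta_mem_K n) r
    · obtain ⟨r, hr⟩ := zeta_mem_of_dvd hn hdn
      rw [zeta_two_mul_odd hd, hr]
      exact neg_mem (pow_mem (pow_mem (zeta_mem_K n) r) _)

/-! ### The rings O_n and o_n -/

theorem zeta_mem_O (n : ℕ) : zeta n ∈ O n := Algebra.self_mem_adjoin_singleton ℤ _

theorem O_subset_K {n : ℕ} {z : ℂ} (hz : z ∈ O n) : z ∈ K n := by
  induction hz using Algebra.adjoin_induction with
  | mem x hx => exact Set.mem_singleton_iff.1 hx ▸ zeta_mem_K n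
  | algebraMap r => simp
  | add x y _ _ hx hy => exact add_mem hx hy
  | mul x y _ _ hx hy => exact mul_mem hx hy

theorem o_subset_k {n : ℕ} {z : ℂ} (hz : z ∈ o n) : z ∈ k n := by
  induction hz using Algebra.adjoin_induction with
  | mem x hx => exact Set.mem_singleton_iff.1 hx ▸ trace_mem_k n
  | algebraMap r => simp
  | add x y _ _ hx hy => exact add_mem hx hy
  | mul x y _ _ hx hy => exact mul_mem hx hy

theorem O_le_iff {N n : ℕ} (hN : N ≠ 0) (hn : n ≠ 0) : O N ≤ O n ↔ K N ≤ K n := by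
  rw [K_le_iff]
  refine ⟨fun h => O_subset_K (h (zeta_mem_O N)), fun h => ?_⟩
  refine Algebra.adjoin_le (Set.singleton_subset_iff.2 ?_)
  rcases eq_pow_or_eq_neg_pow hN hn h with ⟨r, hr⟩ | ⟨-, r, hr⟩ <;> rw [hr]
  · exact pow_mem (zeta_mem_O n) r
  · exact neg_mem (pow_mem (zeta_mem_O n) r)

/-- The traces of the powers of ζ satisfy a Chebyshev recurrence with coefficients in o_n. -/
theorem trace_pow_mem_o (n r : ℕ) : zeta n ^ r + conj (zeta n) ^ r ∈ o n := by
  have h1 : zeta n + conj (zeta n) ∈ o n := Algebra.self_mem_adjoin_singleton ℤ _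
  have h2 : zeta n * conj (zeta n) = 1 := by rw [conj_zeta, mul_inv_cancel₀ (zeta_ne_zero n)]
  induction r using Nat.twoStepInduction with
  | zero => simpa using add_mem (one_mem (o n)) (one_mem (o n))
  | one => simpa using h1
  | more r ih1 ih2 =>
    have : zeta n ^ (r + 2) + conj (zeta n) ^ (r + 2) =
        (zeta n + conj (zeta n)) * (zeta n ^ (r + 1) + conj (zeta n) ^ (r + 1))
          - (zeta n ^ r + conj (zeta n) ^ r) := by
      linear_combination (-(zeta n ^ r + conj (zeta n) ^ r)) * h2
    rw [this]
    exact sub_mem (mul_mem h1 ih2) ih1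

theorem o_le_of_K_le {N n : ℕ} (hN : N ≠ 0) (hn : n ≠ 0) (h : K N ≤ K n) : o N ≤ o n := by
  refine Algebra.adjoin_le (Set.singleton_subset_iff.2 ?_)
  rcases eq_pow_or_eq_neg_pow hN hn (K_le_iff.1 h) with ⟨r, hr⟩ | ⟨-, r, hr⟩ <;> rw [hr]
  · rw [map_pow]; exact trace_pow_mem_o n r
  · rw [map_neg, map_pow, ← neg_add]; exact neg_mem (trace_pow_mem_o n r)

theorem trace_zeta_four : zeta 4 + conj (zeta 4) = 0 := by
  rw [Complex.add_conj, zeta_re]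
  rw [show 2 * Real.pi / ((4 : ℕ) : ℝ) = Real.pi / 2 by push_cast; ring, Real.cos_pi_div_two]
  simp

theorem trace_zeta_six : zeta 6 + conj (zeta 6) = 1 := by
  rw [Complex.add_conj, zeta_re]
  rw [show 2 * Real.pi / ((6 : ℕ) : ℝ) = Real.pi / 3 by push_cast; ring, Real.cos_pi_div_three]
  norm_num

theorem o_le_of_eq {N n : ℕ} (h : N = 4 ∨ N = 6) : o N ≤ o n := by
  refine Algebra.adjoin_le (Set.singleton_subset_iff.2 ?_)
  rcases h with rfl | rfl
  · rw [trace_zeta_four]; exact zero_mem _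
  · rw [trace_zeta_six]; exact one_mem _

theorem k_le_of_o_le {N n : ℕ} (h : o N ≤ o n) : k N ≤ k n := by
  refine IntermediateField.adjoin_le_iff.2 (Set.singleton_subset_iff.2 ?_)
  exact o_subset_k (h (Algebra.self_mem_adjoin_singleton ℤ _))

/-! ### Inclusions between real subfields -/

theorem finrank_adjoin_zeta_le {N n : ℕ} (hn : n ≠ 0)
    (h : zeta N + conj (zeta N) ∈ K n) :
    Module.finrank ℚ (IntermediateField.adjoin (K n) {zeta N}) ≤ 2 * n.totient := by
  have : NeZero n := ⟨hn⟩
  set τ : K n := ⟨zeta N + conj (zeta N), h⟩ with hτ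
  let p : Polynomial (K n) := Polynomial.X ^ 2 - Polynomial.C τ * Polynomial.X + Polynomial.C 1
  have hpm : p.Monic := by unfold p; monicity!
  have hpd : p.natDegree = 2 := by unfold p; compute_degree!
  have hroot : Polynomial.aeval (zeta N) p = 0 := by
    have : algebraMap (K n) ℂ τ = zeta N + conj (zeta N) := rfl
    simp only [p, map_add, map_sub, map_mul, map_pow, Polynomial.aeval_X, Polynomial.aeval_C, this,
      map_one]
    linear_combination zeta_sq N
  have hint : IsIntegral (K n) (zeta N) := ⟨p, hpm, hroot⟩
  have h1 : Module.finrank (K n) (IntermediateField.adjoin (K n) {zeta N}) ≤ 2 := by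
    rw [IntermediateField.adjoin.finrank hint, ← hpd]
    exact Polynomial.natDegree_le_of_dvd (minpoly.dvd _ _ hroot) hpm.ne_zero
  have h2 := Module.finrank_mul_finrank ℚ (K n) (IntermediateField.adjoin (K n) {zeta N})
  rw [IsCyclotomicExtension.finrank (n := n) (K n)
      (Polynomial.cyclotomic.irreducible_rat hn.bot_lt)] at h2
  rw [← h2, mul_comm]
  exact Nat.mul_le_mul_right _ h1

/-- For every other N there is a residue c prime to N strictly between 1 and N − 1: 2 for odd N, and
for N = 2M either M + 1 or M + 2 according to the parity of M. -/
theorem totient_le_two_cases {N : ℕ} (hN : 4 ≤ N) (h : N.totient ≤ 2) : N = 4 ∨ N = 6 := by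
  by_contra hne
  obtain ⟨c, hc1, hcN, hc⟩ : ∃ c, 1 < c ∧ c < N - 1 ∧ N.Coprime c := by
    rcases Nat.even_or_odd N with he | ho
    · obtain ⟨M, rfl⟩ := he.two_dvd
      rcases Nat.even_or_odd M with he' | ho'
      · refine ⟨M + 1, by omega, by omega, Nat.Coprime.mul_left ?_ ?_⟩
        · exact (Even.add_one he').coprime_two_left
        · simp
      · refine ⟨M + 2, by omega, ?_, Nat.Coprime.mul_left ?_ ?_⟩
        · have : M ≠ 3 := by omega
          rcases ho' with ⟨e, rfl⟩
          omega
        · exact (ho'.add_even even_two).coprime_two_left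
        · simpa using ho'.coprime_two_right
    · exact ⟨2, by omega, by omega, ho.coprime_two_right⟩
  have hsub : ({1, c, N - 1} : Finset ℕ) ⊆ (Finset.range N).filter N.Coprime := by
    intro x hx
    simp only [Finset.mem_insert, Finset.mem_singleton] at hx
    simp only [Finset.mem_filter, Finset.mem_range]
    rcases hx with rfl | rfl | rfl
    · exact ⟨by omega, Nat.coprime_one_right N⟩
    · exact ⟨by omega, hc⟩
    · exact ⟨by omega, Nat.coprime_self_sub_right (by omega) |>.2 (Nat.coprime_one_right N)⟩
  have hcard : ({1, c, N - 1} : Finset ℕ).card = 3 :=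
    Finset.card_eq_three.2 ⟨1, c, N - 1, by omega, by omega, by omega, rfl⟩
  have := Finset.card_le_card hsub
  rw [hcard, ← Nat.totient_eq_card_coprime] at this
  omega

/-- The field K_n(ζ_N) has degree at most 2φ(n) and contains a primitive root of unity of order
lcm(N, n). As φ(gcd)φ(lcm) = φ(N)φ(n) and φ(gcd) = 1, this gives φ(N)φ(n) ≤ 2φ(n). -/
theorem totient_le_two_of_gcd_le_two {N n : ℕ} (hN : N ≠ 0) (hn : n ≠ 0)
    (hg : N.gcd n ≤ 2) (h : zeta N + conj (zeta N) ∈ K n) : N.totient ≤ 2 := by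
  have : NeZero n := ⟨hn⟩
  have : NeZero N := ⟨hN⟩
  set F := IntermediateField.adjoin (K n) {zeta N}
  have hfd := finrank_adjoin_zeta_le hn h
  have hN' : IsPrimitiveRoot (⟨zeta N, IntermediateField.mem_adjoin_simple_self _ _⟩ : F) N :=
    IsPrimitiveRoot.coe_submonoidClass_iff.1 (isPrimitiveRoot_zeta hN)
  have hn' : IsPrimitiveRoot (algebraMap (K n) F (zetaK n)) n :=
    (isPrimitiveRoot_zetaK hn).map_of_injective (algebraMap (K n) F).injective
  have : FiniteDimensional (K n) F := by
    refine IntermediateField.adjoin.finiteDimensional ?_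
    exact ((isPrimitiveRoot_zeta hN).isIntegral hN.bot_lt).tower_top
  have : FiniteDimensional ℚ F := FiniteDimensional.trans ℚ (K n) F
  have key := hN'.lcm_totient_le_finrank hn'
      (Polynomial.cyclotomic.irreducible_rat <| Nat.lcm_pos hN.bot_lt hn.bot_lt)
  have h3 : (N.gcd n).totient * (N.lcm n).totient = N.totient * n.totient := by
    have h1 := Nat.totient_gcd_mul_totient_mul (N.gcd n) (N.lcm n)
    have h2 := Nat.totient_gcd_mul_totient_mul N n
    rw [Nat.gcd_eq_left ((Nat.gcd_dvd_left N n).trans (Nat.dvd_lcm_left N n)),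
      Nat.gcd_mul_lcm, h2] at h1
    exact (Nat.eq_of_mul_eq_mul_right (Nat.gcd_pos_of_pos_left n hN.bot_lt) h1).symm
  have h4 : (N.gcd n).totient = 1 := by
    have := Nat.gcd_pos_of_pos_left n hN.bot_lt
    interval_cases N.gcd n <;> rfl
  rw [h4, one_mul] at h3
  have h5 := Nat.totient_pos.2 hn.bot_lt
  refine Nat.le_of_mul_le_mul_right ?_ h5
  rw [← h3]
  exact key.trans hfd

theorem K_le_of_k_le {N n : ℕ} (hN : 4 ≤ N) (hn : n ≠ 0) (h : k N ≤ k n) :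
    (N = 4 ∨ N = 6) ∨ K N ≤ K n := by
  have hτ : zeta N + conj (zeta N) ∈ K n := k_le_K n (h (trace_mem_k N))
  rcases Nat.lt_or_ge (N.gcd n) 3 with hg | hg
  · exact Or.inl (totient_le_two_cases hN
      (totient_le_two_of_gcd_le_two (by omega) hn (by omega) hτ))
  · right
    -- With g = gcd(N, n) ≥ 3, ζ_g is a non-real element of K_N, so K_N = k_N + k_N ζ_g; both k_N
    -- and ζ_g lie in K_n.
    rw [K_le_iff]
    obtain ⟨r, hr⟩ := zeta_mem_of_dvd (by omega : N ≠ 0) (Nat.gcd_dvd_left N n)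
    obtain ⟨s, hs⟩ := zeta_mem_of_dvd hn (Nat.gcd_dvd_right N n)
    obtain ⟨a, ha, b, hb, hab⟩ := exists_real_coordinates (F := K N) (fun z => conj_mem_K)
      (zeta_mem_K N) (hr ▸ pow_mem (zeta_mem_K N) r : zeta (N.gcd n) ∈ K N)
      (conj_ne_of_im_pos (zeta_im_pos hg))
    rw [K_inf_reals (by omega)] at ha hb
    rw [hab, hs]
    exact add_mem (k_le_K n (h ha)) (mul_mem (k_le_K n (h hb)) (pow_mem (zeta_mem_K n) s))

/-! ### Cyclotomic model sets contain homothetic copies of all finite subsets of `K_n` -/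

theorem ext_zetaK {n : ℕ} (hn : n ≠ 0) {f g : K n →ₐ[ℚ] ℂ} (h : f (zetaK n) = g (zetaK n)) :
    f = g := by
  have : NeZero n := ⟨hn⟩
  refine ((isPrimitiveRoot_zetaK hn).powerBasis ℚ).algHom_ext ?_
  simpa using h

/-- An automorphism of `K_n`, as an embedding into `ℂ`. -/
noncomputable def toEmb {n : ℕ} (σ : K n ≃ₐ[ℚ] K n) : K n →ₐ[ℚ] ℂ :=
  (K n).val.comp σ.toAlgHom

@[simp] theorem toEmb_apply {n : ℕ} (σ : K n ≃ₐ[ℚ] K n) (z : K n) : toEmb σ z = (σ z : ℂ) := rfl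

theorem isPrimitiveRoot_toEmb {n : ℕ} (hn : n ≠ 0) (σ : K n ≃ₐ[ℚ] K n) :
    IsPrimitiveRoot (toEmb σ (zetaK n)) n :=
  (isPrimitiveRoot_zetaK hn).map_of_injective (toEmb σ).toRingHom.injective

theorem norm_toEmb {n : ℕ} (hn : n ≠ 0) (σ : K n ≃ₐ[ℚ] K n) : ‖toEmb σ (zetaK n)‖ = 1 :=
  (isPrimitiveRoot_toEmb hn σ).norm'_eq_one hn

theorem conj_toEmb {n : ℕ} (hn : n ≠ 0) (σ : K n ≃ₐ[ℚ] K n) :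
    conj (toEmb σ (zetaK n)) = (toEmb σ (zetaK n))⁻¹ :=
  (Complex.inv_eq_conj (norm_toEmb hn σ)).symm

/-- Complex conjugation on `K_n`. -/
noncomputable def conjK (n : ℕ) : K n →+* K n :=
  (starRingEnd ℂ).restrict (K n) (K n) fun _ hz => conj_mem_K hz

@[simp] theorem coe_conjK {n : ℕ} (z : K n) : (conjK n z : ℂ) = conj (z : ℂ) := rfl

@[simp] theorem conjK_conjK {n : ℕ} (z : K n) : conjK n (conjK n z) = z := by
  ext; simp

theorem conj_mem_O {n : ℕ} (hn : n ≠ 0) {z : ℂ} (hz : z ∈ O n) : conj z ∈ O n := by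
  induction hz using Algebra.adjoin_induction with
  | mem x hx =>
    obtain ⟨l, rfl⟩ := Nat.exists_eq_succ_of_ne_zero hn
    have : conj (zeta (l + 1)) = zeta (l + 1) ^ l := by
      rw [conj_zeta]
      refine inv_eq_of_mul_eq_one_right ?_
      rw [← pow_succ']
      exact (isPrimitiveRoot_zeta hn).pow_eq_one
    rw [Set.mem_singleton_iff.1 hx, Nat.succ_eq_add_one, this]
    exact pow_mem (zeta_mem_O _) l
  | algebraMap r => simp
  | add x y _ _ hx hy => rw [map_add]; exact add_mem hx hy
  | mul x y _ _ hx hy => rw [map_mul]; exact mul_mem hx hy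

theorem mem_O_of_isIntegral {n : ℕ} (hn : n ≠ 0) {z : K n} (hz : IsIntegral ℤ z) :
    (z : ℂ) ∈ O n := by
  have : NeZero n := ⟨hn⟩
  have := IsCyclotomicExtension.Rat.isIntegralClosure_adjoin_singleton (isPrimitiveRoot_zetaK hn)
  obtain ⟨⟨y, hy⟩, rfl⟩ := (IsIntegralClosure.isIntegral_iff
    (A := Algebra.adjoin ℤ {zetaK n})).1 hz
  change (y : ℂ) ∈ O n
  clear this hz
  induction hy using Algebra.adjoin_induction with
  | mem x hx => rw [Set.mem_singleton_iff.1 hx]; exact zeta_mem_O n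
  | algebraMap r => simp
  | add x y _ _ hx hy => exact add_mem hx hy
  | mul x y _ _ hx hy => exact mul_mem hx hy

-- Minkowski's theorem for the convex body with bound 1 at all places but `w₀`, where the bound is
-- enlarged until the volume suffices.
open NumberField in
open NumberField.mixedEmbedding in
theorem exists_integer_small_conjugates {F : Type*} [Field F] [NumberField F]
    (w₀ : InfinitePlace F) :
    ∃ a : 𝓞 F, a ≠ 0 ∧ ∀ w : InfinitePlace F, w ≠ w₀ → w (a : F) < 1 := by
  have hlt := minkowskiBound_lt_top F 1
  obtain ⟨B, hB⟩ : ∃ B : NNReal, minkowskiBound F 1 < (convexBodyLTFactor F) * B := by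
    have h0 : (convexBodyLTFactor F : ENNReal) ≠ 0 := by
      exact_mod_cast convexBodyLTFactor_ne_zero F
    obtain ⟨B, hB⟩ := ENNReal.exists_nat_mul_gt h0 hlt.ne
    exact ⟨B, by rw [mul_comm]; exact_mod_cast hB⟩
  obtain ⟨g, hg, hprod⟩ := adjust_f F (w₁ := w₀) (f := fun _ => 1) B (fun _ _ => one_ne_zero)
  obtain ⟨a, ha, hlt⟩ := exists_ne_zero_mem_ringOfIntegers_lt F (f := g)
    (by rw [convexBodyLT_volume]; convert! hB)
  refine ⟨a, ha, fun w hw => ?_⟩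
  have := hlt w
  rwa [hg w hw, NNReal.coe_one] at this

/-- There is a positive real element of `O_n` whose conjugates other than itself all have modulus
less than `1`. -/
theorem exists_contracting {n : ℕ} (hn : n ≠ 0) :
    ∃ μ : K n, (μ : ℂ) ∈ O n ∧ (∃ r : ℝ, 0 < r ∧ (μ : ℂ) = r) ∧
      ∀ τ : K n ≃ₐ[ℚ] K n, τ ≠ 1 → ¬ ConjugateAut 1 τ → ‖toEmb τ μ‖ < 1 := by
  have : NeZero n := ⟨hn⟩
  obtain ⟨a, ha, hlt⟩ := exists_integer_small_conjugates
    (NumberField.InfinitePlace.mk ((K n).val : K n →+* ℂ))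
  have haO : ((a : K n) : ℂ) ∈ O n := mem_O_of_isIntegral hn a.2
  have ha0 : ((a : K n) : ℂ) ≠ 0 := by simpa using ha
  -- The norm a·ā is real and positive. Its image under τ is small because both τ and τ composed
  -- with conjugation define places other than that of the identity.
  refine ⟨a * conjK n a, mul_mem haO (conj_mem_O hn haO),
    ⟨Complex.normSq ((a : K n) : ℂ), Complex.normSq_pos.2 ha0, Complex.mul_conj _⟩, ?_⟩
  intro τ h1 h2
  have hA : ‖toEmb τ (a : K n)‖ < 1 := by
    refine hlt (NumberField.InfinitePlace.mk (toEmb τ : K n →+* ℂ)) fun h => ?_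
    rcases NumberField.InfinitePlace.mk_eq_iff.1 h with h | h
    · exact h1 (AlgEquiv.ext fun z => Subtype.ext (RingHom.congr_fun h z))
    · refine h2 fun z => ?_
      have := congrArg conj (RingHom.congr_fun h z)
      simpa [NumberField.ComplexEmbedding.conjugate_coe_eq] using this
  have hB : ‖toEmb τ (conjK n a)‖ < 1 := by
    refine hlt (NumberField.InfinitePlace.mk ((toEmb τ : K n →+* ℂ).comp (conjK n))) fun h => ?_
    rcases NumberField.InfinitePlace.mk_eq_iff.1 h with h | h
    · refine h2 fun z => ?_
      have := RingHom.congr_fun h (conjK n z)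
      simpa using this
    · refine h1 (AlgEquiv.ext fun z => Subtype.ext ?_)
      have := congrArg conj (RingHom.congr_fun h (conjK n z))
      simpa [NumberField.ComplexEmbedding.conjugate_coe_eq] using this
  rw [map_mul, norm_mul]
  exact mul_lt_one_of_nonneg_of_lt_one_left (norm_nonneg _) hA hB.le

theorem exists_nat_mul_mem_O {n : ℕ} (hn : n ≠ 0) {z : ℂ} (hz : z ∈ K n) :
    ∃ d : ℕ, d ≠ 0 ∧ (d : ℂ) * z ∈ O n := by
  rw [← IntermediateField.mem_toSubalgebra, toSubalgebra_K hn] at hz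
  induction hz using Algebra.adjoin_induction with
  | mem x hx => exact ⟨1, one_ne_zero, by
      rw [Set.mem_singleton_iff.1 hx]; simpa using zeta_mem_O n⟩
  | algebraMap r =>
    refine ⟨r.den, r.den_ne_zero, ?_⟩
    have : (r.den : ℂ) * (algebraMap ℚ ℂ r) = (r.num : ℤ) := by
      have := Rat.den_mul_eq_num r
      rw [eq_ratCast]
      exact_mod_cast this
    rw [this]
    exact intCast_mem _ _
  | add x y _ _ hx hy =>
    obtain ⟨a, ha, hx⟩ := hx
    obtain ⟨b, hb, hy⟩ := hy
    refine ⟨a * b, mul_ne_zero ha hb, ?_⟩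
    have : ((a * b : ℕ) : ℂ) * (x + y) = b * (a * x) + a * (b * y) := by push_cast; ring
    rw [this]
    exact add_mem (mul_mem (natCast_mem _ _) hx) (mul_mem (natCast_mem _ _) hy)
  | mul x y _ _ hx hy =>
    obtain ⟨a, ha, hx⟩ := hx
    obtain ⟨b, hb, hy⟩ := hy
    refine ⟨a * b, mul_ne_zero ha hb, ?_⟩
    have : ((a * b : ℕ) : ℂ) * (x * y) = (a * x) * (b * y) := by push_cast; ring
    rw [this]
    exact mul_mem hx hy

/-- If the numbers `η i` and their conjugates are pairwise distinct, the vectors of powers of the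
`η i` span the whole space over the reals. -/
theorem span_pow_eq_top {s : ℕ} (η : Fin s → ℂ) (h1 : Function.Injective η)
    (h2 : ∀ i j, η i ≠ conj (η j)) :
    Submodule.span ℝ (Set.range fun (j : ℕ) (i : Fin s) => η i ^ j) = ⊤ := by
  by_contra hne
  obtain ⟨f, hf0, hf⟩ := Submodule.exists_le_ker_of_lt_top _ (lt_top_iff_ne_top.2 hne)
  refine hf0 ?_
  -- A real functional vanishing on the span has the form x ↦ Σ (α i · x i + conjugate). Its
  -- vanishing on all powers is a linear relation between the characters j ↦ z^j of ℕ for 2s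
  -- distinct z, so α = 0 by Dedekind.
  let α : Fin s → ℂ := fun i =>
    (f (Pi.single i 1) - Complex.I * f (Pi.single i Complex.I)) / 2
  have hfx : ∀ x : Fin s → ℂ,
      (f x : ℂ) = ∑ i, (α i * x i + conj (α i) * conj (x i)) := by
    intro x
    have hx : x = ∑ i, ((x i).re • (Pi.single i (1 : ℂ) : Fin s → ℂ)
        + (x i).im • (Pi.single i Complex.I : Fin s → ℂ)) := by
      have : ∀ i, (x i).re • (Pi.single i (1 : ℂ) : Fin s → ℂ)
          + (x i).im • (Pi.single i Complex.I : Fin s → ℂ) = (Pi.single i (x i) : Fin s → ℂ) := by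
        intro i
        rw [← Pi.single_smul, ← Pi.single_smul, ← Pi.single_add]
        congr 1
        simp [Complex.re_add_im]
      simp_rw [this]
      exact (Finset.univ_sum_single x).symm
    conv_lhs => rw [hx]
    rw [map_sum]
    push_cast
    refine Finset.sum_congr rfl fun i _ => ?_
    rw [map_add, map_smul, map_smul]
    simp only [α, map_div₀, map_sub, map_mul, Complex.conj_ofReal, Complex.conj_I, smul_eq_mul,
      map_ofNat]
    conv_rhs => rw [← Complex.re_add_im (x i)]
    simp only [map_add, map_mul, Complex.conj_ofReal, Complex.conj_I]
    push_cast
    linear_combination ((f (Pi.single i Complex.I)) * (x i).im : ℂ) * Complex.I_sq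
  let χ : ℂ → (Multiplicative ℕ →* ℂ) := fun z => powersHom ℂ z
  have hχ : Function.Injective χ := (powersHom ℂ).injective
  let g : Fin s ⊕ Fin s → ℂ := Sum.elim η (fun i => conj (η i))
  have hg : Function.Injective g := by
    rintro (i | i) (j | j) h
    · exact congrArg _ (h1 h)
    · exact absurd h (h2 i j)
    · exact absurd h.symm (h2 j i)
    · exact congrArg _ (h1 ((starRingEnd ℂ).injective h))
  have hli := (linearIndependent_monoidHom (Multiplicative ℕ) ℂ).comp _ (hχ.comp hg)
  have hα : ∀ i, α i = 0 := by
    intro i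
    refine Fintype.linearIndependent_iff.1 hli (Sum.elim α fun i => conj (α i)) ?_ (Sum.inl i)
    ext j
    have hj : f (fun i => η i ^ (Multiplicative.toAdd j)) = 0 :=
      hf (Submodule.subset_span ⟨Multiplicative.toAdd j, rfl⟩)
    have := hfx (fun i => η i ^ (Multiplicative.toAdd j))
    rw [hj, Finset.sum_add_distrib] at this
    simp only [Fintype.sum_sum_type, Finset.sum_apply, Function.comp, Pi.smul_apply,
      Sum.elim_inl, Sum.elim_inr, g, χ, powersHom_apply, smul_eq_mul, Pi.zero_apply]
    simpa using this.symm
  refine LinearMap.ext fun x => ?_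
  have := hfx x
  simp only [hα, map_zero, zero_mul, add_zero, Finset.sum_const_zero] at this
  exact_mod_cast this

theorem IsStarFamily.span_eq_top {n : ℕ} (hn : 3 ≤ n)
    {σ : Fin (Nat.totient n / 2 - 1) → (K n ≃ₐ[ℚ] K n)} (hσ : IsStarFamily n σ) :
    Submodule.span ℝ (Set.range fun (j : Fin n) i => toEmb (σ i) (zetaK n) ^ (j : ℕ)) = ⊤ := by
  have hn0 : n ≠ 0 := by omega
  have hreal : ∀ i, toEmb (σ i) (zetaK n) ≠ conj (toEmb (σ i) (zetaK n)) := by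
    intro i h
    rw [conj_toEmb hn0] at h
    have hp := isPrimitiveRoot_toEmb hn0 (σ i)
    have h2 : toEmb (σ i) (zetaK n) ^ 2 = 1 := by
      rw [sq]
      nth_rw 2 [h]
      exact mul_inv_cancel₀ (hp.ne_zero hn0)
    have := Nat.le_of_dvd (by norm_num) (hp.dvd_of_pow_eq_one 2 h2)
    omega
  have htop := span_pow_eq_top (fun i => toEmb (σ i) (zetaK n)) ?_ ?_
  · rw [← htop]
    congr 1
    ext x
    constructor
    · rintro ⟨j, rfl⟩; exact ⟨j, rfl⟩
    · rintro ⟨j, rfl⟩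
      -- The exponents matter only modulo n, so finitely many powers span.
      refine ⟨⟨j % n, Nat.mod_lt _ (by omega)⟩, ?_⟩
      funext i
      exact (pow_eq_pow_mod j (isPrimitiveRoot_toEmb hn0 (σ i)).pow_eq_one).symm
  · intro i j h
    have h1 := hσ.2 (σ j) (hσ.1 j).1 (hσ.1 j).2
    refine h1.unique (Or.inl ?_) (Or.inl rfl)
    have := ext_zetaK hn0 h
    exact AlgEquiv.ext fun z => Subtype.ext (AlgHom.congr_fun this z)
  · intro i j h
    have hc : ConjugateAut (σ j) (σ i) := by
      have h3 := ext_zetaK hn0 (f := toEmb (σ i))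
        (g := ((Complex.conjAe.restrictScalars ℚ : ℂ ≃ₐ[ℚ] ℂ) : ℂ →ₐ[ℚ] ℂ).comp (toEmb (σ j))) h
      exact fun z => AlgHom.congr_fun h3 z
    have h1 := hσ.2 (σ j) (hσ.1 j).1 (hσ.1 j).2
    obtain rfl := h1.unique (Or.inr hc) (Or.inl rfl)
    exact hreal i h

/-- Every finite family in `K_n` has a homothetic copy in a given cyclotomic model set. -/
theorem IsCyclotomicModelSet.exists_homothety {n : ℕ} (hn : 3 ≤ n) {Λ : Set ℂ}
    (hΛ : IsCyclotomicModelSet n Λ) {ι : Type*} [Fintype ι] (f : ι → ℂ) (hf : ∀ i, f i ∈ K n) :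
    ∃ r : ℝ, 0 < r ∧ ∃ t : ℂ, ∀ i, (r : ℂ) * f i + t ∈ Λ := by
  have hn0 : n ≠ 0 := by omega
  obtain ⟨σ, hσ, W, ⟨c, hc⟩, -, t, rfl⟩ := hΛ
  obtain ⟨ε, hε, hball⟩ := Metric.mem_nhds_iff.1 (mem_interior_iff_mem_nhds.1 hc)
  obtain ⟨μ, hμO, ⟨r, hr, hμr⟩, hμ⟩ := exists_contracting hn0
  have hlt : ∀ i, ‖toEmb (σ i) μ‖ < 1 := fun i => hμ _ (hσ.1 i).1 (hσ.1 i).2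
  choose d hd0 hd using fun i => exists_nat_mul_mem_O hn0 (hf i)
  set D : ℕ := ∏ i, d i with hD
  have hD0 : D ≠ 0 := Finset.prod_ne_zero_iff.2 fun i _ => hd0 i
  have hDf : ∀ i, (D : ℂ) * f i ∈ O n := by
    intro i
    obtain ⟨e, he⟩ := Finset.dvd_prod_of_mem d (Finset.mem_univ i)
    rw [← hD] at he
    rw [he, Nat.cast_mul, mul_comm (d i : ℂ), mul_assoc]
    exact mul_mem (natCast_mem _ _) (hd i)
  let F : ι → K n := fun i => ⟨(D : ℂ) * f i, O_subset_K (hDf i)⟩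
  -- In this bound, n accounts for rounding n coefficients below, and the sum for the star images of
  -- the points themselves.
  obtain ⟨k, hk⟩ : ∃ k : ℕ, ∀ i, ‖toEmb (σ i) μ‖ ^ k *
      (n + ∑ a, ‖toEmb (σ i) (F a)‖) < ε := by
    have : ∀ᶠ k : ℕ in Filter.atTop, ∀ i, ‖toEmb (σ i) μ‖ ^ k *
        (n + ∑ a, ‖toEmb (σ i) (F a)‖) < ε := by
      rw [Filter.eventually_all]
      intro i
      have h1 := (tendsto_pow_atTop_nhds_zero_of_lt_one (norm_nonneg _) (hlt i)).mul_const
        ((n : ℝ) + ∑ a, ‖toEmb (σ i) (F a)‖)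
      rw [zero_mul] at h1
      exact h1.eventually (gt_mem_nhds hε)
    exact this.exists
  have hμ0 : μ ≠ 0 := by
    rintro rfl
    have : r = 0 := Complex.ofReal_eq_zero.1 hμr.symm
    exact hr.ne' this
  have hσμ : ∀ i, toEmb (σ i) μ ^ k ≠ 0 := fun i =>
    pow_ne_zero _ ((map_ne_zero (toEmb (σ i))).2 hμ0)
  have hspan : (fun i => c i / toEmb (σ i) μ ^ k) ∈
      Submodule.span ℝ (Set.range fun (j : Fin n) i => toEmb (σ i) (zetaK n) ^ (j : ℕ)) := by
    rw [hσ.span_eq_top hn]; trivial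
  obtain ⟨x, hx⟩ := (Submodule.mem_span_range_iff_exists_fun ℝ).1 hspan
  have hx' : ∀ i, c i = ∑ j, (x j : ℂ) * toEmb (σ i) (zetaK n) ^ (j : ℕ) * toEmb (σ i) μ ^ k := by
    intro i
    have := congrFun hx i
    rw [eq_div_iff (hσμ i)] at this
    rw [← this, Finset.sum_apply, Finset.sum_mul]
    simp
  -- The centre c is a real combination of the star images of ζ^j μ^k. Rounding the coefficients
  -- down gives an element of O_n whose star image is near c, since these star images are small.
  let z₀ : K n := ∑ j : Fin n, (⌊x j⌋ : K n) * zetaK n ^ (j : ℕ) * μ ^ k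
  have hz₀O : (z₀ : ℂ) ∈ O n := by
    simp only [z₀, AddSubmonoidClass.coe_finsetSum]
    refine sum_mem fun j _ => ?_
    push_cast
    exact mul_mem (mul_mem (intCast_mem _ _) (pow_mem (zeta_mem_O n) _)) (pow_mem hμO k)
  have hz₀ : ∀ i, ‖toEmb (σ i) z₀ - c i‖ ≤ ‖toEmb (σ i) μ‖ ^ k * n := by
    intro i
    simp only [z₀, map_sum, map_mul, map_pow, map_intCast]
    rw [hx' i, ← Finset.sum_sub_distrib]
    calc _ ≤ ∑ j : Fin n, ‖toEmb (σ i) μ‖ ^ k := by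
          refine (norm_sum_le _ _).trans (Finset.sum_le_sum fun j _ => ?_)
          rw [← sub_mul, ← sub_mul, norm_mul, norm_mul, norm_pow, norm_pow, norm_toEmb hn0, one_pow,
            mul_one]
          have : ‖((⌊x j⌋ : ℂ) - (x j : ℂ))‖ ≤ 1 := by
            rw [← Complex.ofReal_intCast, ← Complex.ofReal_sub, Complex.norm_real,
              Real.norm_eq_abs, abs_sub_comm, Int.self_sub_floor,
              abs_of_nonneg (Int.fract_nonneg (x j))]
            exact (Int.fract_lt_one (x j)).le
          exact mul_le_of_le_one_left (by positivity) this
      _ = _ := by simp [mul_comm]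
  refine ⟨r ^ k * D, by positivity, z₀ + t, fun a => ?_⟩
  refine ⟨z₀ + μ ^ k * F a, ?_, ?_, ?_⟩
  · exact add_mem hz₀O (mul_mem (pow_mem hμO k) (hDf a))
  · apply hball
    rw [Metric.mem_ball, dist_pi_lt_iff hε]
    intro i
    rw [dist_eq_norm]
    change ‖toEmb (σ i) (z₀ + μ ^ k * F a) - c i‖ < ε
    refine lt_of_le_of_lt ?_ (hk i)
    rw [map_add, map_mul, map_pow, add_sub_right_comm]
    refine (norm_add_le _ _).trans ?_
    rw [mul_add]
    refine add_le_add (hz₀ i) ?_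
    rw [norm_mul, norm_pow]
    refine mul_le_mul_of_nonneg_left ?_ (by positivity)
    exact Finset.single_le_sum (f := fun a => ‖toEmb (σ i) (F a)‖) (fun _ _ => norm_nonneg _)
      (Finset.mem_univ a)
  · simp only [F]
    push_cast
    rw [hμr]
    ring

/-! ### The field generated by a model set -/

theorem IsCyclotomicModelSet.sub_mem_O {n : ℕ} {Λ : Set ℂ} (hΛ : IsCyclotomicModelSet n Λ)
    {z : ℂ} (hz : z ∈ Λ - Λ) : z ∈ O n := by
  obtain ⟨σ, -, W, -, -, t, rfl⟩ := hΛ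
  obtain ⟨_, ⟨x, hx, -, rfl⟩, _, ⟨y, hy, -, rfl⟩, rfl⟩ := hz
  change (x : ℂ) + t - (y + t) ∈ O n
  rw [add_sub_add_right_eq_sub]
  exact sub_mem hx hy

theorem IsCyclotomicModelSet.KSet_eq {n : ℕ} (hn : 3 ≤ n) {Λ : Set ℂ}
    (hΛ : IsCyclotomicModelSet n Λ) : KSet Λ = K n := by
  refine le_antisymm (IntermediateField.adjoin_le_iff.2 ?_) ?_
  · rintro _ (hz | ⟨z, hz, rfl⟩)
    · exact O_subset_K (hΛ.sub_mem_O hz)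
    · exact conj_mem_K (O_subset_K (hΛ.sub_mem_O hz))
  · refine IntermediateField.adjoin_le_iff.2 (Set.singleton_subset_iff.2 ?_)
    -- In a homothetic copy of 0, 1, ζ_n, the number ζ_n is a quotient of differences.
    obtain ⟨r, hr, t, h⟩ := hΛ.exists_homothety hn (![0, 1, zeta n] : Fin 3 → ℂ) (by
      intro i
      fin_cases i
      · exact zero_mem _
      · exact one_mem _
      · exact zeta_mem_K n)
    have h0 := h 0
    have h1 := h 1
    have h2 := h 2
    simp only [Matrix.cons_val_zero, Matrix.cons_val_one, Matrix.cons_val, mul_zero, zero_add,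
      mul_one] at h0 h1 h2
    have hd1 : (r : ℂ) ∈ KSet Λ := IntermediateField.subset_adjoin _ _
      (Or.inl ⟨_, h1, _, h0, by simp⟩)
    have hd2 : (r : ℂ) * zeta n ∈ KSet Λ := IntermediateField.subset_adjoin _ _
      (Or.inl ⟨_, h2, _, h0, by simp⟩)
    have hr0 : (r : ℂ) ≠ 0 := by exact_mod_cast hr.ne'
    have := div_mem hd2 hd1
    rwa [mul_div_cancel_left₀ _ hr0] at this

theorem IsCyclotomicModelSet.kSet_eq {n : ℕ} (hn : 3 ≤ n) {Λ : Set ℂ}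
    (hΛ : IsCyclotomicModelSet n Λ) : kSet Λ = k n := by
  rw [kSet, hΛ.KSet_eq hn, K_inf_reals hn]

/-! ### Convex polygons -/

/-- The determinant of two plane vectors. -/
def cross (a b : ℂ) : ℝ := a.re * b.im - a.im * b.re

theorem im_conj_mul (a b : ℂ) : (conj a * b).im = cross a b := by
  simp [cross]; ring

theorem cross_sub (a b c : ℂ) : cross a (b - c) = cross a b - cross a c := by
  simp [cross]; ring

theorem cross_real_mul (r : ℝ) (a b : ℂ) : cross a (r * b) = r * cross a b := by
  simp [cross]; ring

theorem real_mul_cross (r : ℝ) (a b : ℂ) : cross (r * a) b = r * cross a b := by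
  simp [cross]; ring

@[simp] theorem cross_zero (a : ℂ) : cross a 0 = 0 := by simp [cross]

@[simp] theorem zero_cross (a : ℂ) : cross 0 a = 0 := by simp [cross]

theorem cross_pluecker (a b c d : ℂ) :
    cross a b * cross c d - cross a c * cross b d + cross a d * cross b c = 0 := by
  simp only [cross]; ring

theorem exists_eq_real_mul {a b : ℂ} (ha : a ≠ 0) (h : cross a b = 0) : ∃ r : ℝ, b = r * a := by
  have hb : (conj a * b).im = 0 := by rw [im_conj_mul, h]
  have hc : conj a ≠ 0 := (map_ne_zero _).2 ha
  refine ⟨(conj a * b).re / Complex.normSq a, ?_⟩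
  have h1 : ((conj a * b).re : ℂ) = conj a * b := by
    apply Complex.ext <;> simp [hb]
  rw [Complex.ofReal_div, h1, ← Complex.mul_conj]
  field_simp

theorem eq_zero_of_cross {a b z : ℂ} (hab : cross a b ≠ 0) (h1 : cross a z = 0)
    (h2 : cross b z = 0) : z = 0 := by
  have ha : a ≠ 0 := by rintro rfl; simp at hab
  obtain ⟨r, rfl⟩ := exists_eq_real_mul ha h1
  rw [cross_real_mul] at h2
  rcases mul_eq_zero.1 h2 with h | h
  · simp [h]
  · exact absurd (by simp only [cross] at h ⊢; linarith) hab

theorem Parallel.cross_eq_zero {a b : ℂ} (h : Parallel a b) (z : ℂ) (hz : cross a z = 0) :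
    cross b z = 0 := by
  obtain ⟨r, -, rfl⟩ := h
  rw [real_mul_cross, hz, mul_zero]

theorem intCast_ne_of_lt {m : ℕ} {a b : ℤ} (h1 : a < b) (h2 : b < a + m) :
    (b : ZMod m) ≠ (a : ZMod m) := by
  intro h
  rw [eq_comm, ZMod.intCast_eq_intCast_iff_dvd_sub] at h
  obtain ⟨c, hc⟩ := h
  have hm : (0 : ℤ) < m := by linarith
  have : 0 < c := by
    by_contra hc0
    nlinarith
  nlinarith

/-- Three vertices met in this order along the boundary form a positively oriented triangle. -/
theorem IsConvexPolygon.orientation {m : ℕ} {v : ZMod m → ℂ} (hv : IsConvexPolygon v) {a b c : ℤ}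
    (hab : a < b) (hbc : b < c) (hc : c < a + m) :
    0 < cross (v (b : ℤ) - v (a : ℤ)) (v (c : ℤ) - v (a : ℤ)) := by
  have edge : ∀ i j : ℤ, i + 1 < j → j < i + m →
      0 < cross (v ((i + 1 : ℤ)) - v (i : ℤ)) (v (j : ℤ) - v (i : ℤ)) := by
    intro i j h1 h2
    have h := hv.2 i j (intCast_ne_of_lt (by omega) h2) (by
      have := intCast_ne_of_lt (m := m) (a := i + 1) (b := j) h1 (by omega)
      simpa using this)
    rw [im_conj_mul] at h
    simpa using h
  have next : ∀ j : ℤ, a < j → j + 1 < a + m →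
      0 < cross (v (j : ℤ) - v (a : ℤ)) (v ((j + 1 : ℤ)) - v (a : ℤ)) := by
    intro j h1 h2
    have h := edge j (a + m) (by omega) (by omega)
    have hp : ((a + m : ℤ) : ZMod m) = (a : ZMod m) := by simp
    rw [hp] at h
    simp only [cross, Complex.sub_re, Complex.sub_im] at h ⊢
    linarith
  rcases eq_or_lt_of_le (Int.add_one_le_iff.2 hab) with h1 | h1
  · rw [← h1]; exact edge a c (by omega) hc
  · induction c, (Int.add_one_le_iff.2 hbc) using Int.leInduction with
    | base => exact next b hab hc
    | succ c hle ih =>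
      have e1 := ih (by omega) (by omega)
      have e2 := next c (by omega) (by omega)
      have e3 := edge a b h1 (by omega)
      have e4 := edge a c (by omega) (by omega)
      have e5 := edge a (c + 1) (by omega) (by omega)
      -- All determinants in this relation other than that of b and c + 1 are known to be positive,
      -- which forces its sign as well.
      have P := cross_pluecker (v ((a + 1 : ℤ)) - v (a : ℤ)) (v (b : ℤ) - v (a : ℤ))
        (v (c : ℤ) - v (a : ℤ)) (v ((c + 1 : ℤ)) - v (a : ℤ))
      by_contra hneg
      have := mul_pos e3 e2
      have := mul_pos e5 e1
      have := mul_nonneg e4.le (neg_nonneg.2 (not_lt.1 hneg))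
      linarith

theorem IsConvexPolygon.vertex_ne {m : ℕ} {v : ZMod m → ℂ} (hv : IsConvexPolygon v) {a b : ℤ}
    (hab : a < b) (hb : b < a + m) : v (b : ℤ) ≠ v (a : ℤ) := by
  have hm := hv.1
  intro h
  rcases lt_or_ge (b + 1) (a + m) with h1 | h1
  · have := hv.orientation hab (lt_add_one b) h1
    simp [h] at this
  · have := hv.orientation (lt_add_one a) (show a + 1 < b by omega) hb
    simp [h] at this

/-- For a chord parallel to an edge of a convex polygon, the vertices between its end points are
farther from the edge than the chord, and the remaining ones are nearer. -/
theorem IsConvexPolygon.chord {m : ℕ} {v : ZMod m → ℂ} (hv : IsConvexPolygon v) {e p q x : ℤ}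
    (hp : e < p) (hpq : p < q) (hq : q ≤ e + m) (hx : e < x) (hx' : x ≤ e + m)
    (h : cross (v ((e + 1 : ℤ)) - v (e : ℤ)) (v (p : ℤ)) =
      cross (v ((e + 1 : ℤ)) - v (e : ℤ)) (v (q : ℤ))) :
    (p < x → x < q → cross (v ((e + 1 : ℤ)) - v (e : ℤ)) (v (p : ℤ)) <
      cross (v ((e + 1 : ℤ)) - v (e : ℤ)) (v (x : ℤ))) ∧
    (x < p ∨ q < x → cross (v ((e + 1 : ℤ)) - v (e : ℤ)) (v (x : ℤ)) <
      cross (v ((e + 1 : ℤ)) - v (e : ℤ)) (v (p : ℤ))) := by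
  have hm := hv.1
  set E := v ((e + 1 : ℤ)) - v (e : ℤ) with hE
  have hE0 : E ≠ 0 := sub_ne_zero.2 (hv.vertex_ne (lt_add_one e) (by omega))
  have hEe : cross E (v ((e + 1 : ℤ))) = cross E (v (e : ℤ)) := by
    simp only [hE, cross, Complex.sub_re, Complex.sub_im]; ring
  obtain ⟨r, hr⟩ := exists_eq_real_mul hE0 (b := v (q : ℤ) - v (p : ℤ)) (by
    rw [cross_sub, h, sub_self])
  have inside : p < x → x < q → r * (cross E (v (x : ℤ)) - cross E (v (p : ℤ))) < 0 := by
    intro h1 h2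
    have := hv.orientation h1 h2 (by omega)
    rw [hr, cross_real_mul] at this
    simp only [cross, Complex.sub_re, Complex.sub_im] at this ⊢
    linarith
  have outside : ∀ y : ℤ, e < y → y ≤ e + m → y < p ∨ q < y →
      0 < r * (cross E (v (y : ℤ)) - cross E (v (p : ℤ))) := by
    rintro y h1 h2 (h3 | h3)
    · have h4 := hv.orientation h3 hpq (by omega)
      have h5 : cross (v (p : ℤ) - v (y : ℤ)) (v (q : ℤ) - v (y : ℤ)) =
          cross (v (q : ℤ) - v (p : ℤ)) (v (y : ℤ) - v (p : ℤ)) := by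
        simp only [cross, Complex.sub_re, Complex.sub_im]; ring
      rwa [h5, hr, real_mul_cross, cross_sub] at h4
    · have h4 := hv.orientation hpq h3 (by omega)
      rwa [hr, real_mul_cross, cross_sub] at h4
  have height : ∀ y : ℤ, e + 1 < y → y < e + m → cross E (v (e : ℤ)) < cross E (v (y : ℤ)) := by
    intro y h1 h2
    have := hv.orientation (lt_add_one e) h1 h2
    rwa [cross_sub, sub_pos] at this
  -- The chord runs opposite to the edge: either it is the edge reversed, or `e + 1` lies outside
  -- the chord and is lower than p, which fixes the sign.
  have hr0 : r < 0 := by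
    rcases eq_or_lt_of_le (Int.add_one_le_iff.2 hp) with h1 | h1
    · rcases eq_or_lt_of_le hq with h2 | h2
      · have hper : ((e + m : ℤ) : ZMod m) = (e : ZMod m) := by simp
        rw [h2, hper, ← h1, ← neg_sub, ← hE] at hr
        have : ((r : ℂ) + 1) * E = 0 := by linear_combination -hr
        rcases mul_eq_zero.1 this with h3 | h3
        · have : r + 1 = 0 := by exact_mod_cast h3
          linarith
        · exact absurd h3 hE0
      · exfalso
        have := height q (by omega) h2
        rw [← h, ← h1, hEe] at this
        exact lt_irrefl _ this
    · have h2 := outside (e + 1) (by omega) (by omega) (Or.inl h1)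
      have h3 := height p h1 (by omega)
      rw [hEe] at h2
      nlinarith
  refine ⟨fun h1 h2 => ?_, fun h1 => ?_⟩
  · have := inside h1 h2
    nlinarith
  · have := outside x hx hx' h1
    nlinarith

/-- If every vertex of a convex polygon lies on a chord parallel to the edge `e`, these chords join
the pairs of vertices that are symmetric with respect to the edge. -/
theorem IsConvexPolygon.cross_eq_of_add_eq {m : ℕ} {v : ZMod m → ℂ} (hv : IsConvexPolygon v)
    {e : ℤ} (H : ∀ i : ZMod m, ∃ j : ZMod m, j ≠ i ∧
      cross (v ((e + 1 : ℤ)) - v (e : ℤ)) (v j) = cross (v ((e + 1 : ℤ)) - v (e : ℤ)) (v i))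
    {a b : ℤ} (hab : a + b = 2 * e + 1) :
    cross (v ((e + 1 : ℤ)) - v (e : ℤ)) (v (a : ℤ)) =
      cross (v ((e + 1 : ℤ)) - v (e : ℤ)) (v (b : ℤ)) := by
  have hm := hv.1
  have : NeZero m := ⟨by omega⟩
  have hm0 : (0 : ℤ) < m := by omega
  set h : ℤ → ℝ := fun x => cross (v ((e + 1 : ℤ)) - v (e : ℤ)) (v (x : ℤ)) with hh
  have hper : ∀ x y : ℤ, h (x + m * y) = h x := by
    intro x y
    simp [hh]
  have hchord : ∀ p q x : ℤ, e < p → p < q → q ≤ e + m → e < x → x ≤ e + m → h p = h q →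
      (p < x → x < q → h p < h x) ∧ (x < p ∨ q < x → h x < h p) :=
    fun p q x h1 h2 h3 h4 h5 h6 => hv.chord h1 h2 h3 h4 h5 h6
  have hrep : ∀ x : ℤ, ∃ y c : ℤ, e < y ∧ y ≤ e + m ∧ y = x + m * c := by
    intro x
    refine ⟨e + 1 + (x - e - 1) % m, -((x - e - 1) / m), ?_, ?_, ?_⟩
    · have := Int.emod_nonneg (x - e - 1) hm0.ne'
      omega
    · have := Int.emod_lt_of_pos (x - e - 1) hm0
      omega
    · have := Int.emod_add_mul_ediv (x - e - 1) m
      linear_combination this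
  have partner : ∀ p : ℤ, e < p → p ≤ e + m → ∃ q : ℤ, e < q ∧ q ≤ e + m ∧ q ≠ p ∧ h q = h p := by
    intro p h1 h2
    obtain ⟨j, hj, hj'⟩ := H (p : ℤ)
    obtain ⟨y, c, hy1, hy2, hy⟩ := hrep (j.val : ℤ)
    have hyj : ((y : ℤ) : ZMod m) = j := by
      rw [hy]; simp
    refine ⟨y, hy1, hy2, ?_, ?_⟩
    · rintro rfl; exact hj hyj.symm
    · simp only [hh, hyj]; exact hj'
  -- Induction outward from the edge, with the edge itself as the first chord. The pairs already
  -- matched are lower than all vertices between them, so the next two positions have their partners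
  -- within the remaining range.
  have main : ∀ k : ℕ, ∀ p : ℤ, p = e + 1 + k → 2 * p < 2 * e + m + 1 →
      h (2 * e + m + 1 - p) = h p := by
    intro k
    induction k using Nat.strong_induction_on with
    | _ k ih =>
      intro p hpk hp2
      have ih' : ∀ y : ℤ, e < y → y < p → h (2 * e + m + 1 - y) = h y := fun y h1 h2 =>
        ih (y - e - 1).toNat (by omega) y (by omega) (by omega)
      -- positions outside `[p, s]` are lower than those inside
      have lower : ∀ x y : ℤ, p ≤ x → x ≤ 2 * e + m + 1 - p → e < y → y ≤ e + m → h y = h x →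
          p ≤ y ∧ y ≤ 2 * e + m + 1 - p := by
        intro x y h1 h2 h3 h4 h5
        by_contra hcon
        rcases lt_or_ge y p with h6 | h6
        · have h7 := (hchord y (2 * e + m + 1 - y) x h3 (by omega) (by omega) (by omega) (by omega)
            (ih' y h3 h6).symm).1 (by omega) (by omega)
          linarith
        · have h8 := ih' (2 * e + m + 1 - y) (by omega) (by omega)
          rw [sub_sub_cancel] at h8
          have h7 := (hchord (2 * e + m + 1 - y) y x (by omega) (by omega) (by omega) (by omega)
            (by omega) h8.symm).1 (by omega) (by omega)
          linarith
      obtain ⟨q, hq1, hq2, hqp, hq⟩ := partner p (by omega) (by omega)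
      obtain ⟨l, hl1, hl2, hlp, hl⟩ := partner (2 * e + m + 1 - p) (by omega) (by omega)
      have hq3 := lower p q le_rfl (by omega) hq1 hq2 hq
      have hl3 := lower _ l (by omega) le_rfl hl1 hl2 hl
      rcases eq_or_lt_of_le hq3.2 with h1 | h1
      · rw [← h1]; exact hq
      · exfalso
        -- If p were matched short of the symmetric position, that position would be strictly lower
        -- than p; but its own partner makes p level with it or lower.
        have h2 := (hchord p q (2 * e + m + 1 - p) (by omega) (by omega) (by omega) (by omega)
          (by omega) hq.symm).2 (Or.inr h1)
        rcases eq_or_lt_of_le hl3.1 with h3 | h3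
        · rw [← h3] at hl; linarith
        · have h4 := (hchord l (2 * e + m + 1 - p) p (by omega) (by omega) (by omega) (by omega)
            (by omega) hl).2 (Or.inl h3)
          linarith
  have main' : ∀ p : ℤ, e < p → p ≤ e + m → h (2 * e + m + 1 - p) = h p := by
    intro p h1 h2
    rcases lt_trichotomy (2 * p) (2 * e + m + 1) with h3 | h3 | h3
    · exact main (p - e - 1).toNat p (by omega) h3
    · congr 1; omega
    · have := main (2 * e + m + 1 - p - e - 1).toNat (2 * e + m + 1 - p) (by omega) (by omega)
      rw [sub_sub_cancel] at this
      exact this.symm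
  change h a = h b
  obtain ⟨y, c, hy1, hy2, hy⟩ := hrep a
  have h1 := main' y hy1 hy2
  rw [← hper a c, ← hy, ← h1, show 2 * e + m + 1 - y = b + m * (1 - c) by rw [hy]; linarith, hper]

/-! ### Polygons satisfying a three-term recurrence -/

/-- The sequence `0, 1, t, t² - 1, …` with `a (i + 2) = t * a (i + 1) - a i`. -/
noncomputable def lucas (t : ℝ) : ℕ → ℝ
  | 0 => 0
  | 1 => 1
  | (i + 2) => t * lucas t (i + 1) - lucas t i

theorem lucas_add_two (t : ℝ) (i : ℕ) :
    lucas t (i + 2) = t * lucas t (i + 1) - lucas t i := by rw [lucas]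

theorem lucas_zero (t : ℝ) : lucas t 0 = 0 := by rw [lucas]

theorem lucas_one (t : ℝ) : lucas t 1 = 1 := by rw [lucas]

/-- Since ρ(t − ρ) = 1, the expression does not change from i to i + 1. -/
theorem lucas_root {t : ℝ} {ρ : ℂ} (hρ : ρ * ρ = t * ρ - 1) (i : ℕ) :
    ((lucas t (i + 1) : ℂ) - ρ * lucas t i) * ρ ^ i = 1 := by
  induction i with
  | zero => simp [lucas_zero, lucas_one]
  | succ i ih =>
    rw [lucas_add_two]
    push_cast
    rw [← ih, pow_succ]
    linear_combination (-(lucas t (i + 1) : ℂ) * ρ ^ i) * hρ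

theorem eq_lucas {t : ℝ} {D : ℕ → ℂ} (hD : ∀ i, D (i + 2) = t * D (i + 1) - D i) (i : ℕ) :
    D (i + 1) = lucas t (i + 1) * D 1 - lucas t i * D 0 := by
  induction i using Nat.twoStepInduction with
  | zero => simp [lucas_zero, lucas_one]
  | one => rw [hD, lucas_add_two, lucas_one, lucas_zero]; push_cast; ring
  | more i h1 h2 =>
    rw [hD, h1, h2, lucas_add_two t (i + 1), lucas_add_two t i]
    push_cast
    ring

theorem eq_zero_and_eq_zero_of_cross {a b : ℂ} (hab : cross a b ≠ 0) {x y : ℝ}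
    (h : (x : ℂ) * a + y * b = 0) : x = 0 ∧ y = 0 := by
  have h1 : cross (x * a + y * b) b = 0 := by rw [h]; simp
  have h2 : cross (x * a + y * b) a = 0 := by rw [h]; simp
  have e1 : cross (x * a + y * b) b = x * cross a b := by simp [cross]; ring
  have e2 : cross (x * a + y * b) a = -y * cross a b := by simp [cross]; ring
  rw [e1] at h1
  rw [e2] at h2
  exact ⟨(mul_eq_zero.1 h1).resolve_right hab, neg_eq_zero.1 ((mul_eq_zero.1 h2).resolve_right hab)⟩

/-- If the edges of a closed polygon with `N` distinct vertices satisfy a recurrence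
`D (i + 2) = t D (i + 1) - D i`, then `t = ρ + ρ⁻¹` for a primitive `N`-th root of unity `ρ`. -/
theorem exists_primitiveRoot_of_recurrence {N : ℕ} (hN : 0 < N) {A : ℕ → ℂ} {t : ℝ}
    (hper : ∀ i, A (i + N) = A i) (hinj : ∀ k, 0 < k → k < N → A k ≠ A 0)
    (hrec : ∀ i, A (i + 3) - A (i + 2) = t * (A (i + 2) - A (i + 1)) - (A (i + 1) - A i))
    (hnd : cross (A 1 - A 0) (A 2 - A 1) ≠ 0) :
    ∃ ρ : ℂ, IsPrimitiveRoot ρ N ∧ (t : ℂ) = ρ + ρ⁻¹ := by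
  obtain ⟨s, hs⟩ := IsAlgClosed.exists_pow_nat_eq ((t : ℂ) ^ 2 - 4) (n := 2) (by norm_num)
  set ρ : ℂ := (t + s) / 2 with hρdef
  have hρ : ρ * ρ = t * ρ - 1 := by rw [hρdef]; linear_combination hs / 4
  have hρ0 : ρ ≠ 0 := by intro h; rw [h] at hρ; norm_num at hρ
  have hρ' : ρ⁻¹ * ρ⁻¹ = t * ρ⁻¹ - 1 := by
    field_simp; linear_combination hρ
  have ht : (t : ℂ) = ρ + ρ⁻¹ := by
    rw [← mul_right_inj' hρ0, mul_add, mul_inv_cancel₀ hρ0]; linear_combination -hρ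
  set D : ℕ → ℂ := fun i => A (i + 1) - A i with hDdef
  have hD : ∀ i, D (i + 2) = t * D (i + 1) - D i := hrec
  have hDnd : cross (D 0) (D 1) ≠ 0 := hnd
  have hlN : lucas t N = 0 ∧ lucas t (N + 1) = 1 := by
    have h1 : D (N + 1) = D 1 := by
      have h3 := hper 1
      have h4 := hper 2
      rw [add_comm] at h3 h4
      change A (N + 1 + 1) - A (N + 1) = A 2 - A 1
      rw [h3, ← h4]
    rw [eq_lucas hD] at h1
    obtain ⟨h2, h3⟩ := eq_zero_and_eq_zero_of_cross hDnd (x := -lucas t N)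
      (y := lucas t (N + 1) - 1) (by push_cast; linear_combination h1)
    exact ⟨neg_eq_zero.1 h2, sub_eq_zero.1 h3⟩
  have hρN : ρ ^ N = 1 := by
    have := lucas_root hρ N
    rw [hlN.1, hlN.2] at this
    simpa using this
  -- Suppose ρ^k = 1 with 0 < k < N. If ρ ≠ ρ⁻¹, the edges have period k, so advancing by k is a
  -- translation; N repetitions return to the start, so it is trivial and two vertices coincide. If
  -- ρ = ρ⁻¹, `lucas t i` is i times a unit and cannot vanish at N.
  refine ⟨ρ, IsPrimitiveRoot.mk_of_lt ρ hN hρN fun k hk0 hkN hk => ?_, ht⟩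
  have e1 := lucas_root hρ k
  have e2 := lucas_root hρ' k
  rw [inv_pow, hk] at e2
  rw [hk] at e1
  have e3 : (lucas t k : ℂ) * (ρ - ρ⁻¹) = 0 := by linear_combination -e1 + e2
  rcases mul_eq_zero.1 e3 with h0 | h0
  · have hk1 : lucas t k = 0 := by exact_mod_cast h0
    have hk2 : lucas t (k + 1) = 1 := by
      rw [hk1] at e1
      simp only [Complex.ofReal_zero, mul_zero, sub_zero, mul_one] at e1
      exact_mod_cast e1
    have hDk1 : D (k + 1) = D 1 := by rw [eq_lucas hD, hk1, hk2]; simp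
    have hDk : D k = D 0 := by
      obtain ⟨l, rfl⟩ := Nat.exists_eq_succ_of_ne_zero hk0.ne'
      rw [Nat.succ_eq_add_one] at *
      rw [lucas_add_two, hk1] at hk2
      have : lucas t l = -1 := by linarith
      rw [eq_lucas hD, hk1, this]; simp
    have hDper : ∀ i, D (i + k) = D i := by
      intro i
      induction i using Nat.twoStepInduction with
      | zero => simpa using hDk
      | one => simpa [add_comm] using hDk1
      | more i h1 h2 =>
        rw [show i + 2 + k = i + k + 2 by ring, hD, hD i, h1, show i + k + 1 = i + 1 + k by ring, h2]
    have hA : ∀ i, A (i + k) = A i + (A k - A 0) := by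
      intro i
      induction i with
      | zero => simp
      | succ i ih =>
        have := hDper i
        simp only [hDdef] at this
        rw [show i + 1 + k = i + k + 1 by ring]
        linear_combination this + ih
    have hA' : ∀ j : ℕ, A (j * k) = A 0 + j * (A k - A 0) := by
      intro j
      induction j with
      | zero => simp
      | succ j ih =>
        rw [Nat.succ_mul, hA, ih]; push_cast; ring
    have hperj : ∀ j : ℕ, A (j * N) = A 0 := by
      intro j
      induction j with
      | zero => simp
      | succ j ih => rw [Nat.succ_mul, hper, ih]
    have h5 := hA' N
    rw [mul_comm, hperj] at h5
    have h6 : (N : ℂ) * (A k - A 0) = 0 := by linear_combination -h5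
    rcases mul_eq_zero.1 h6 with h7 | h7
    · exact hN.ne' (by exact_mod_cast h7)
    · exact hinj k hk0 hkN (sub_eq_zero.1 h7)
  · have hinv : ρ * ρ = 1 := by
      have : ρ⁻¹ = ρ := (sub_eq_zero.1 h0).symm
      nth_rw 2 [← this]
      exact mul_inv_cancel₀ hρ0
    have hform : ∀ i : ℕ, (lucas t i : ℂ) * ρ = i * ρ ^ i := by
      intro i
      induction i with
      | zero => simp [lucas_zero]
      | succ i ih =>
        have h1 := lucas_root hρ i
        have h2 : ρ ^ i * ρ ^ i = 1 := by rw [← mul_pow, hinv, one_pow]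
        have h3 : (lucas t (i + 1) : ℂ) - ρ * lucas t i = ρ ^ i := by
          linear_combination ρ ^ i * h1 - ((lucas t (i + 1) : ℂ) - ρ * lucas t i) * h2
        push_cast
        linear_combination ρ * h3 + ρ * ih
    have h1 := hform N
    rw [hlN.1, hρN] at h1
    simp at h1
    exact hN.ne (by exact_mod_cast h1)

theorem pow_add_inv_pow_mem {F : IntermediateField ℚ ℂ} {ρ : ℂ} (h0 : ρ ≠ 0)
    (h : ρ + ρ⁻¹ ∈ F) (j : ℕ) : ρ ^ j + (ρ ^ j)⁻¹ ∈ F := by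
  induction j using Nat.twoStepInduction with
  | zero => simpa using add_mem (one_mem F) (one_mem F)
  | one => simpa using h
  | more i h1 h2 =>
    have : ρ ^ (i + 2) + (ρ ^ (i + 2))⁻¹ =
        (ρ + ρ⁻¹) * (ρ ^ (i + 1) + (ρ ^ (i + 1))⁻¹) - (ρ ^ i + (ρ ^ i)⁻¹) := by
      field_simp
      ring
    rw [this]
    exact sub_mem (mul_mem h h2) h1

/-- ζ_N is a power of ρ, so its trace is a polynomial in that of ρ; which primitive root occurs is
irrelevant. -/
theorem k_le_of_primitiveRoot {N : ℕ} (hN : N ≠ 0) {F : IntermediateField ℚ ℂ} {ρ : ℂ}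
    (hρ : IsPrimitiveRoot ρ N) (h : ρ + ρ⁻¹ ∈ F) : k N ≤ F := by
  have : NeZero N := ⟨hN⟩
  refine IntermediateField.adjoin_le_iff.2 (Set.singleton_subset_iff.2 ?_)
  obtain ⟨j, -, hj⟩ := hρ.eq_pow_of_pow_eq_one (isPrimitiveRoot_zeta hN).pow_eq_one
  rw [conj_zeta, ← hj]
  exact pow_add_inv_pow_mem (hρ.ne_zero hN) h j

theorem div_mem_kSet {Λ : Set ℂ} {x y : ℂ} {r : ℝ} (hx : x ∈ KSet Λ) (hy : y ∈ KSet Λ)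
    (hy0 : y ≠ 0) (h : x = r * y) : (r : ℂ) ∈ kSet Λ := by
  refine ⟨?_, mem_reals.2 (Complex.conj_ofReal r)⟩
  have hr : (r : ℂ) = x / y := by rw [h, mul_div_cancel_right₀ _ hy0]
  exact hr ▸ div_mem hx hy

theorem sub_mem_KSet {Λ : Set ℂ} {x y : ℂ} (hx : x ∈ Λ) (hy : y ∈ Λ) : x - y ∈ KSet Λ :=
  IntermediateField.subset_adjoin _ _ (Or.inl ⟨x, hx, y, hy, rfl⟩)

theorem cross_eq_combination {a b c : ℂ} (h : cross a b ≠ 0) :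
    ∃ x y : ℝ, ∀ z, cross c z = x * cross a z + y * cross b z := by
  refine ⟨cross c b / cross a b, cross a c / cross a b, fun z => ?_⟩
  field_simp
  simp only [cross]; ring

/-- In a `U`-polygon with four consecutive edges in directions of `U`, every other vertex gives a
closed polygon whose edges satisfy a three-term recurrence. -/
theorem exists_recurrence {m : ℕ} (hm : 8 ≤ m) {v : ZMod m → ℂ} (hv : IsConvexPolygon v) {e : ℤ}
    (H : ∀ s : ℤ, 0 ≤ s → s < 4 → ∀ a b : ℤ, a + b = 2 * (e + s) + 1 →
      cross (v ((e + s + 1 : ℤ)) - v ((e + s : ℤ))) (v (a : ℤ)) =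
      cross (v ((e + s + 1 : ℤ)) - v ((e + s : ℤ))) (v (b : ℤ))) :
    ∃ t : ℝ, ∀ i : ℤ, v ((e + 2 * i + 6 : ℤ)) - v ((e + 2 * i + 4 : ℤ)) =
      t * (v ((e + 2 * i + 4 : ℤ)) - v ((e + 2 * i + 2 : ℤ)))
        - (v ((e + 2 * i + 2 : ℤ)) - v ((e + 2 * i : ℤ))) := by
  set E : ℤ → ℂ := fun s => v ((e + s + 1 : ℤ)) - v ((e + s : ℤ)) with hE
  have hturn : ∀ s, cross (E s) (E (s + 1)) ≠ 0 := by
    intro s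
    have := hv.orientation (lt_add_one (e + s)) (lt_add_one (e + s + 1)) (by omega)
    have h2 : E (s + 1) = v ((e + s + 1 + 1 : ℤ)) - v ((e + s : ℤ)) - E s := by
      simp only [hE, add_assoc]
      rw [sub_sub_sub_cancel_right]
    rw [h2, cross_sub]
    have h3 : cross (E s) (E s) = 0 := by simp only [cross]; ring
    rw [h3, sub_zero]
    exact this.ne'
  have hnz : cross (E 1) (E 2) ≠ 0 := hturn 1
  obtain ⟨x0, y0, h0⟩ := cross_eq_combination (c := E 0) hnz
  obtain ⟨x3, y3, h3⟩ := cross_eq_combination (c := E 3) hnz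
  have hy0 : y0 ≠ 0 := by
    rintro rfl
    have := h0 (E 1)
    have h4 : cross (E 1) (E 1) = 0 := by simp only [cross]; ring
    rw [h4] at this
    exact hturn 0 (by simpa using this)
  have hx3 : x3 ≠ 0 := by
    rintro rfl
    have := h3 (E 2)
    have h4 : cross (E 2) (E 2) = 0 := by simp only [cross]; ring
    rw [h4] at this
    refine hturn 2 ?_
    have h5 : cross (E 2) (E 3) = -cross (E 3) (E 2) := by simp only [cross]; ring
    change cross (E 2) (E 3) = 0
    rw [h5, this]; simp
  set V : ℤ → ℂ := fun a => v (a : ℤ) with hV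
  have R0 : ∀ a b : ℤ, a + b = 2 * e + 1 →
      x0 * cross (E 1) (V a) + y0 * cross (E 2) (V a) =
      x0 * cross (E 1) (V b) + y0 * cross (E 2) (V b) := by
    intro a b hab
    rw [← h0, ← h0]; exact H 0 le_rfl (by norm_num) a b (by linarith)
  have R1 : ∀ a b : ℤ, a + b = 2 * e + 3 → cross (E 1) (V a) = cross (E 1) (V b) :=
    fun a b hab => H 1 (by norm_num) (by norm_num) a b (by linarith)
  have R2 : ∀ a b : ℤ, a + b = 2 * e + 5 → cross (E 2) (V a) = cross (E 2) (V b) :=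
    fun a b hab => H 2 (by norm_num) (by norm_num) a b (by linarith)
  have R3 : ∀ a b : ℤ, a + b = 2 * e + 7 →
      x3 * cross (E 1) (V a) + y3 * cross (E 2) (V a) =
      x3 * cross (E 1) (V b) + y3 * cross (E 2) (V b) := by
    intro a b hab
    rw [← h3, ← h3]; exact H 3 (by norm_num) (by norm_num) a b (by linarith)
  -- both coordinates satisfy first-order relations
  have S0 : ∀ a : ℤ, y0 * (cross (E 2) (V (a + 4)) - cross (E 2) (V a)) =
      -x0 * (cross (E 1) (V (a + 2)) - cross (E 1) (V a)) := by
    intro a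
    have r0 := R0 a (2 * e + 1 - a) (by ring)
    rw [R1 (2 * e + 1 - a) (a + 2) (by ring), R2 (2 * e + 1 - a) (a + 4) (by ring)] at r0
    linarith
  have S3 : ∀ a : ℤ, x3 * (cross (E 1) (V (a + 4)) - cross (E 1) (V a)) =
      -y3 * (cross (E 2) (V (a + 4)) - cross (E 2) (V (a + 2))) := by
    intro a
    have r0 := R3 (a + 4) (2 * e + 3 - a) (by ring)
    rw [R1 (2 * e + 3 - a) a (by ring), R2 (2 * e + 3 - a) (a + 2) (by ring)] at r0
    linarith
  -- Let X = cross (E 1) V and Y = cross (E 2) V. Adding `S3` at a and a + 2 and eliminating Y by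
  -- `S0` expresses X(a+6) + X(a+4) − X(a+2) − X(a) as a multiple of X(a+4) − X(a+2). The left side
  -- contains that difference twice, hence the −2.
  refine ⟨x0 * y3 / (y0 * x3) - 2, fun i => sub_eq_zero.1 (eq_zero_of_cross hnz ?_ ?_)⟩
  all_goals
    set a := e + 2 * i with ha
    have s1 := S0 a
    have s2 := S0 (a + 2)
    have s3 := S3 a
    have s4 := S3 (a + 2)
    rw [add_assoc a 2 4, add_assoc a 2 2] at s2 s4
    norm_num at s2 s4
    change cross _ (V (a + 6) - V (a + 4) - (((_ : ℝ) : ℂ) * (V (a + 4) - V (a + 2)) -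
      (V (a + 2) - V a))) = 0
    rw [cross_sub, cross_sub, cross_sub, cross_real_mul, cross_sub, cross_sub]
    have hne : y0 * x3 ≠ 0 := mul_ne_zero hy0 hx3
    field_simp
  · linear_combination y0 * s3 + y0 * s4 - y3 * s2
  · linear_combination x3 * s1 + x3 * s2 - x0 * s3

/-- The coefficient t of the recurrence is the trace of a primitive root of unity of order m/2, and
also a real quotient of two elements of K_Λ. -/
theorem k_le_kSet_of_isUPolygon {m : ℕ} (hm : 8 ≤ m) (hm' : Even m) {Λ : Set ℂ} {U : Finset ℂ}
    {v : ZMod m → ℂ} (hΛ : ∀ i, v i ∈ Λ) (hU : IsUPolygon U v) (hc : HasConsecutive U v 4) :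
    k (m / 2) ≤ kSet Λ := by
  have : NeZero m := ⟨by omega⟩
  obtain ⟨-, hv, hchord⟩ := hU
  obtain ⟨i0, hi0⟩ := hc
  obtain ⟨e, rfl⟩ : ∃ e : ℤ, (e : ZMod m) = i0 := ⟨i0.val, by simp⟩
  have H : ∀ s : ℤ, 0 ≤ s → s < 4 → ∀ a b : ℤ, a + b = 2 * (e + s) + 1 →
      cross (v ((e + s + 1 : ℤ)) - v ((e + s : ℤ))) (v (a : ℤ)) =
      cross (v ((e + s + 1 : ℤ)) - v ((e + s : ℤ))) (v (b : ℤ)) := by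
    intro s hs0 hs4 a b hab
    refine hv.cross_eq_of_add_eq (fun i => ?_) hab
    obtain ⟨u, hu, hpar⟩ := hi0 s.toNat (by omega)
    have hcast : ((s.toNat : ℕ) : ZMod m) = (s : ZMod m) := by
      rw [← Int.cast_natCast, Int.toNat_of_nonneg hs0]
    rw [hcast] at hpar
    obtain ⟨j, hji, r, hr⟩ := hchord i u hu
    refine ⟨j, hji, ?_⟩
    have h1 := hpar.cross_eq_zero (v j - v i) (by
      rw [hr, add_sub_cancel_left, cross_real_mul]
      simp only [cross]; ring)
    rw [cross_sub, sub_eq_zero] at h1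
    push_cast
    exact h1
  obtain ⟨t, ht⟩ := exists_recurrence hm hv H
  obtain ⟨N, rfl⟩ := hm'.two_dvd
  rw [Nat.mul_div_cancel_left _ (by norm_num)]
  have hcross : 0 < cross (v ((e + 2 : ℤ)) - v (e : ℤ)) (v ((e + 4 : ℤ)) - v ((e + 2 : ℤ))) := by
    have h1 := hv.orientation (a := e) (b := e + 2) (c := e + 4) (by omega) (by omega) (by omega)
    simp only [cross, Complex.sub_re, Complex.sub_im] at h1 ⊢
    linarith
  obtain ⟨ρ, hρ, htρ⟩ : ∃ ρ : ℂ, IsPrimitiveRoot ρ N ∧ (t : ℂ) = ρ + ρ⁻¹ := by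
    refine exists_primitiveRoot_of_recurrence (by omega) (A := fun i => v ((e + 2 * i : ℤ)))
      ?_ ?_ ?_ ?_
    · intro i
      congr 1
      have := ZMod.natCast_self (2 * N)
      push_cast at this ⊢
      linear_combination this
    · intro l hl0 hl
      simpa using hv.vertex_ne (a := e) (b := e + 2 * l) (by omega) (by push_cast; omega)
    · intro i
      have := ht i
      simp only [Nat.cast_add, Nat.cast_ofNat, mul_add, ← add_assoc]
      norm_num
      convert! this using 3 <;> norm_num
    · norm_num
      simpa using hcross.ne'
  refine k_le_of_primitiveRoot (by omega) hρ ?_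
  rw [← htρ]
  have hy0 : v ((e + 2 * 0 + 4 : ℤ)) - v ((e + 2 * 0 + 2 : ℤ)) ≠ 0 := by
    refine sub_ne_zero.2 (hv.vertex_ne (by omega) (by omega))
  refine div_mem_kSet (x := v ((e + 2 * 0 + 6 : ℤ)) - v ((e + 2 * 0 + 4 : ℤ)) +
    (v ((e + 2 * 0 + 2 : ℤ)) - v ((e + 2 * 0 : ℤ)))) (add_mem ?_ ?_) ?_ hy0 ?_
  · exact sub_mem_KSet (hΛ _) (hΛ _)
  · exact sub_mem_KSet (hΛ _) (hΛ _)
  · exact sub_mem_KSet (hΛ _) (hΛ _)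
  · rw [ht 0]; ring

/-! ### Affinely regular polygons and the field of a point set -/

theorem affine_sub (ψ : ℂ ≃ᵃ[ℝ] ℂ) (x y : ℂ) : ψ x - ψ y = ψ.linear (x - y) := by
  have := (ψ : ℂ →ᵃ[ℝ] ℂ).linearMap_vsub x y
  simpa using this.symm

theorem linear_real_mul (f : ℂ ≃ₗ[ℝ] ℂ) (r : ℝ) (z : ℂ) : f (r * z) = r * f z := by
  rw [← Complex.real_smul, map_smul, Complex.real_smul]

theorem affinelyRegular_natCast {m : ℕ} (hm : m ≠ 0) {v : ZMod m → ℂ} {ψ : ℂ ≃ᵃ[ℝ] ℂ}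
    (h : ∀ i : ZMod m, v i = ψ (zeta m ^ i.val)) (j : ℕ) : v (j : ZMod m) = ψ (zeta m ^ j) := by
  rw [h, ZMod.val_natCast]
  congr 1
  exact (pow_eq_pow_mod j (isPrimitiveRoot_zeta hm).pow_eq_one).symm

/-- The trace `ζ_m + conj ζ_m` as a real number. -/
noncomputable def traceR (m : ℕ) : ℝ := 2 * (zeta m).re

theorem coe_traceR (m : ℕ) : (traceR m : ℂ) = zeta m + (zeta m)⁻¹ := by
  rw [← conj_zeta, Complex.add_conj, traceR]

theorem k_le_iff {m : ℕ} {F : IntermediateField ℚ ℂ} : k m ≤ F ↔ zeta m + (zeta m)⁻¹ ∈ F := by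
  rw [k, IntermediateField.adjoin_le_iff, Set.singleton_subset_iff, conj_zeta]; rfl

theorem k_le_of_dvd {N L : ℕ} (hL : L ≠ 0) (h : N ∣ L) : k N ≤ k L := by
  obtain ⟨r, hr⟩ := zeta_mem_of_dvd hL h
  rw [k_le_iff, hr]
  exact pow_add_inv_pow_mem (zeta_ne_zero L) (k_le_iff.1 le_rfl) r

/-- The chord from vertex 0 to vertex 3 is parallel to the edge from 1 to 2, with ratio 1 + ζ + ζ⁻¹,
and affine maps preserve such ratios. -/
theorem k_le_kSet_of_isAffinelyRegular {L : ℕ} {Λ : Set ℂ} {v : ZMod L → ℂ}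
    (hv : IsAffinelyRegular v) (hΛ : ∀ i, v i ∈ Λ) : k L ≤ kSet Λ := by
  obtain ⟨hconv, ψ, hψ⟩ := hv
  have hL := hconv.1
  have hL0 : L ≠ 0 := by omega
  have hv := affinelyRegular_natCast hL0 hψ
  have h0 := zeta_ne_zero L
  have key : v (3 : ℕ) - v (0 : ℕ) = ((1 + traceR L : ℝ) : ℂ) * (v (2 : ℕ) - v (1 : ℕ)) := by
    rw [hv, hv, hv, hv, affine_sub, affine_sub, ← linear_real_mul]
    congr 1
    push_cast
    rw [coe_traceR]
    field_simp
    ring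
  have hne : v (2 : ℕ) - v (1 : ℕ) ≠ 0 := by
    have := hconv.vertex_ne (a := 1) (b := 2) (by omega) (by omega)
    rw [sub_ne_zero]
    exact_mod_cast this
  have h1 := div_mem_kSet (sub_mem_KSet (hΛ _) (hΛ _)) (sub_mem_KSet (hΛ _) (hΛ _)) hne key
  rw [k_le_iff, ← coe_traceR]
  have h2 := sub_mem h1 (one_mem (kSet Λ))
  push_cast at h2
  rwa [add_sub_cancel_left] at h2

theorem exists_kSet_coordinates {Λ : Set ℂ} {a b z : ℂ} (ha : a ∈ KSet Λ) (hb : b ∈ KSet Λ)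
    (hz : z ∈ KSet Λ) (hab : cross a b ≠ 0) :
    ∃ x y : ℝ, (x : ℂ) ∈ kSet Λ ∧ (y : ℂ) ∈ kSet Λ ∧ z = x * a + y * b := by
  have ha0 : a ≠ 0 := by rintro rfl; simp at hab
  obtain ⟨x, hx, y, hy, h⟩ := exists_real_coordinates (F := KSet Λ) (fun z => conj_mem_KSet)
    (div_mem hz ha) (div_mem hb ha) (by
      intro hc
      obtain ⟨r, hr⟩ := Complex.conj_eq_iff_real.1 hc
      rw [div_eq_iff ha0] at hr
      rw [hr, cross_real_mul] at hab
      apply hab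
      simp only [cross]; ring)
  obtain ⟨x', rfl⟩ := Complex.conj_eq_iff_real.1 (mem_reals.1 hx.2)
  obtain ⟨y', rfl⟩ := Complex.conj_eq_iff_real.1 (mem_reals.1 hy.2)
  refine ⟨x', y', hx, hy, ?_⟩
  field_simp at h
  linear_combination h

/-- The edges E are known only up to real factors r. Coordinates of each direction in terms of the
two preceding ones lie in k_Λ, and in −yy′/x′ the unknown factors cancel, leaving the square of the
trace of ζ_{2N}. That square minus 2 is the trace of ζ_N. -/
theorem k_le_kSet_of_directions {m : ℕ} (hm : 8 ≤ m) (hm' : Even m) {Λ : Set ℂ} {U : Finset ℂ}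
    {v : ZMod m → ℂ} (hU : ∀ u ∈ U, IsLambdaDirection Λ u) (hv : IsAffinelyRegular v)
    (hc : HasConsecutive U v 4) : k (m / 2) ≤ kSet Λ := by
  obtain ⟨N, rfl⟩ := hm'.two_dvd
  rw [Nat.mul_div_cancel_left _ (by norm_num)]
  obtain ⟨hconv, ψ, hψ⟩ := hv
  have hm0 : 2 * N ≠ 0 := by omega
  have : NeZero (2 * N) := ⟨hm0⟩
  have hvψ := affinelyRegular_natCast hm0 hψ
  obtain ⟨i0, hi0⟩ := hc
  obtain ⟨a, rfl⟩ : ∃ a : ℕ, (a : ZMod (2 * N)) = i0 := ⟨i0.val, by simp⟩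
  set E : ℕ → ℂ := fun j => v ((a + j + 1 : ℕ)) - v ((a + j : ℕ)) with hE
  have hdir : ∀ j, j < 4 → ∃ d ∈ KSet Λ, ∃ r : ℝ, r ≠ 0 ∧ E j = r * d := by
    intro j hj
    obtain ⟨u, hu, r, hr, hpar⟩ := hi0 j hj
    obtain ⟨-, d, hd, -, s, hs, hds⟩ := hU u hu
    refine ⟨d, IntermediateField.subset_adjoin _ _ (Or.inl hd), r / s, div_ne_zero hr hs, ?_⟩
    have hs' : (s : ℂ) ≠ 0 := by exact_mod_cast hs
    have : E j = r * u := by rw [← hpar, hE]; push_cast; rfl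
    rw [this, hds]; push_cast; field_simp
  have hrec : ∀ j, E (j + 2) = traceR (2 * N) * E (j + 1) - E j := by
    intro j
    simp only [hE]
    rw [hvψ, hvψ, hvψ, hvψ, hvψ, hvψ, affine_sub, affine_sub, affine_sub, ← linear_real_mul,
      ← map_sub]
    congr 1
    rw [coe_traceR]
    have := zeta_ne_zero (2 * N)
    field_simp
    ring
  have hturn : ∀ j, cross (E j) (E (j + 1)) ≠ 0 := by
    intro j
    have h1 := hconv.orientation (a := a + j) (b := a + j + 1) (c := a + j + 2) (by omega)
      (by omega) (by omega)
    have h2 : cross (E j) (E (j + 1)) = cross (v ((a + j + 1 : ℤ)) - v ((a + j : ℤ)))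
        (v ((a + j + 2 : ℤ)) - v ((a + j : ℤ))) := by
      simp only [hE, cross, Complex.sub_re, Complex.sub_im]
      push_cast
      rw [← add_assoc, show (a : ZMod (2 * N)) + j + 2 = a + j + 1 + 1 by ring]
      ring
    rw [h2]
    exact h1.ne'
  obtain ⟨d0, hd0, r0, hr0, h0⟩ := hdir 0 (by norm_num)
  obtain ⟨d1, hd1, r1, hr1, h1⟩ := hdir 1 (by norm_num)
  obtain ⟨d2, hd2, r2, hr2, h2⟩ := hdir 2 (by norm_num)
  obtain ⟨d3, hd3, r3, hr3, h3⟩ := hdir 3 (by norm_num)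
  have hc01 : cross d0 d1 ≠ 0 := by
    have := hturn 0
    rw [zero_add, h0, h1, real_mul_cross, cross_real_mul] at this
    exact right_ne_zero_of_mul (right_ne_zero_of_mul this)
  have hc12 : cross d1 d2 ≠ 0 := by
    have := hturn 1
    rw [h1, h2, real_mul_cross, cross_real_mul] at this
    exact right_ne_zero_of_mul (right_ne_zero_of_mul this)
  obtain ⟨x, y, hx, hy, hxy⟩ := exists_kSet_coordinates hd0 hd1 hd2 hc01
  obtain ⟨x', y', hx', hy', hxy'⟩ := exists_kSet_coordinates hd1 hd2 hd3 hc12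
  have e2 := hrec 0
  have e3 := hrec 1
  simp only [zero_add, Nat.reduceAdd] at e2 e3
  rw [h2, h1, h0, hxy] at e2
  rw [h3, h2, h1, hxy'] at e3
  obtain ⟨f1, f2⟩ := eq_zero_and_eq_zero_of_cross hc01 (x := r2 * x + r0)
    (y := r2 * y - traceR (2 * N) * r1) (by push_cast; linear_combination e2)
  obtain ⟨g1, g2⟩ := eq_zero_and_eq_zero_of_cross hc12 (x := r3 * x' + r1)
    (y := r3 * y' - traceR (2 * N) * r2) (by push_cast; linear_combination e3)
  have hx'0 : x' ≠ 0 := by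
    rintro rfl
    apply hr1
    linarith
  have hsq : traceR (2 * N) ^ 2 = -(y * y') / x' := by
    rw [eq_div_iff hx'0]
    have : r2 * r3 * (traceR (2 * N) ^ 2 * x') = r2 * r3 * -(y * y') := by
      have hx'r : r3 * x' = -r1 := by linarith
      have h4 : r2 * y = traceR (2 * N) * r1 := by linarith
      have h5 : r3 * y' = traceR (2 * N) * r2 := by linarith
      linear_combination r2 * traceR (2 * N) ^ 2 * hx'r + r3 * y' * h4 + traceR (2 * N) * r1 * h5
    exact mul_left_cancel₀ (mul_ne_zero hr2 hr3) this
  have hmem : (traceR (2 * N) : ℂ) ^ 2 ∈ kSet Λ := by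
    have : (traceR (2 * N) : ℂ) ^ 2 = -((y : ℂ) * y') / x' := by exact_mod_cast hsq
    rw [this]
    exact div_mem (neg_mem (mul_mem hy hy')) hx'
  rw [k_le_iff]
  have hN : zeta N + (zeta N)⁻¹ = (traceR (2 * N) : ℂ) ^ 2 - 2 := by
    rw [coe_traceR, ← zeta_pow_mul (a := 2) (b := N) (by norm_num)]
    have := zeta_ne_zero (2 * N)
    field_simp
    ring
  rw [hN]
  exact sub_mem hmem (ofNat_mem (kSet Λ) 2)

/-! ### Construction of polygons inscribed in an ellipse -/

/-- The closed polygon given by a periodic sequence of points. -/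
noncomputable def polygonOf (m : ℕ) (g : ℤ → ℂ) : ZMod m → ℂ := fun i => g i.val

theorem polygonOf_intCast {m : ℕ} (hm : m ≠ 0) {g : ℤ → ℂ} (hg : ∀ k, g (k + m) = g k) (k : ℤ) :
    polygonOf m g (k : ZMod m) = g k := by
  have : NeZero m := ⟨hm⟩
  have hper : Function.Periodic g (m : ℤ) := hg
  rw [polygonOf, ZMod.val_intCast]
  conv_rhs => rw [← Int.emod_add_mul_ediv k m, mul_comm]
  exact (hper.int_mul (k / m) (k % m)).symm

/-- The direction of a chord of the circle depends only on the sum of its two angles; this is the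
source of all parallel chords below. -/
theorem exp_sub_exp (a b : ℝ) : Complex.exp (b * Complex.I) - Complex.exp (a * Complex.I) =
    ((2 * Real.sin ((b - a) / 2) : ℝ) : ℂ) *
      (Complex.I * Complex.exp (((a + b) / 2 : ℝ) * Complex.I)) := by
  have h1 : (b : ℂ) * Complex.I =
      ((a + b) / 2 : ℝ) * Complex.I + ((b - a) / 2 : ℝ) * Complex.I := by push_cast; ring
  have h2 : (a : ℂ) * Complex.I =
      ((a + b) / 2 : ℝ) * Complex.I + -((b - a) / 2 : ℝ) * Complex.I := by push_cast; ring
  rw [h1, h2, Complex.exp_add, Complex.exp_add]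
  push_cast
  rw [Complex.two_sin]
  linear_combination (Complex.exp (((a : ℂ) + b) / 2 * Complex.I) *
    (Complex.exp (((b : ℂ) - a) / 2 * Complex.I) - Complex.exp (-(((b : ℂ) - a) / 2) * Complex.I)))
    * Complex.I_sq

theorem cross_I_mul_exp (x y : ℝ) : cross (Complex.I * Complex.exp (x * Complex.I))
    (Complex.I * Complex.exp (y * Complex.I)) = Real.sin (y - x) := by
  rw [Real.sin_sub]
  simp [cross, Complex.exp_ofReal_mul_I_re, Complex.exp_ofReal_mul_I_im]
  ring

theorem cross_exp_pos {a b c : ℝ} (h1 : a < b) (h2 : b < c) (h3 : c < a + 2 * Real.pi) :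
    0 < cross (Complex.exp (b * Complex.I) - Complex.exp (a * Complex.I))
      (Complex.exp (c * Complex.I) - Complex.exp (a * Complex.I)) := by
  rw [exp_sub_exp, exp_sub_exp, real_mul_cross, cross_real_mul, cross_I_mul_exp]
  have s1 : 0 < Real.sin ((b - a) / 2) := Real.sin_pos_of_pos_of_lt_pi (by linarith) (by linarith)
  have s2 : 0 < Real.sin ((c - a) / 2) := Real.sin_pos_of_pos_of_lt_pi (by linarith) (by linarith)
  have s3 : 0 < Real.sin ((a + c) / 2 - (a + b) / 2) :=
    Real.sin_pos_of_pos_of_lt_pi (by linarith) (by linarith)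
  positivity

section Circle

variable {m : ℕ} {θ : ℤ → ℝ} {f : ℂ →ₗ[ℝ] ℂ} {δ : ℝ} {t : ℂ}

theorem periodic_of_angle (hper : ∀ k, θ (k + m) = θ k + 2 * Real.pi) (k : ℤ) :
    f (Complex.exp (θ (k + m) * Complex.I)) + t = f (Complex.exp (θ k * Complex.I)) + t := by
  rw [hper]
  push_cast
  rw [add_mul, Complex.exp_add, Complex.exp_two_pi_mul_I, mul_one]

/-- The image of a polygon inscribed in the unit circle under an orientation-preserving affine map
is a convex polygon. -/
theorem isConvexPolygon_of_angle (hm : 3 ≤ m) (hmono : StrictMono θ)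
    (hper : ∀ k, θ (k + m) = θ k + 2 * Real.pi) (hδ : 0 < δ)
    (hf : ∀ x y, cross (f x) (f y) = δ * cross x y) :
    IsConvexPolygon (polygonOf m fun k => f (Complex.exp (θ k * Complex.I)) + t) := by
  refine ⟨hm, fun i j h1 h2 => ?_⟩
  have hm0 : m ≠ 0 := by omega
  have hm' : (0 : ℤ) < m := by omega
  have : NeZero m := ⟨hm0⟩
  have hval := polygonOf_intCast hm0
    (g := fun k => f (Complex.exp (θ k * Complex.I)) + t) (periodic_of_angle hper)
  obtain ⟨a, rfl⟩ : ∃ a : ℤ, (a : ZMod m) = i := ⟨i.val, by simp⟩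
  obtain ⟨c, hc1, hc2, rfl⟩ : ∃ c : ℤ, a ≤ c ∧ c < a + m ∧ (c : ZMod m) = j := by
    refine ⟨a + (j.val - a) % m, ?_, ?_, ?_⟩
    · have := Int.emod_nonneg (j.val - a) hm'.ne'
      omega
    · have := Int.emod_lt_of_pos (j.val - a) hm'
      omega
    · simp
  have hca : c ≠ a := by rintro rfl; exact h1 rfl
  have hca' : c ≠ a + 1 := by rintro rfl; exact h2 (by push_cast; rfl)
  have hcast : (a : ZMod m) + 1 = ((a + 1 : ℤ) : ZMod m) := by push_cast; rfl
  rw [im_conj_mul, hcast, hval, hval, hval, add_sub_add_right_eq_sub, add_sub_add_right_eq_sub,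
    ← map_sub, ← map_sub, hf]
  refine mul_pos hδ (cross_exp_pos (hmono (lt_add_one a)) (hmono (by omega)) ?_)
  rw [← hper]
  exact hmono hc2

theorem exists_affineEquiv (hδ : 0 < δ) (hf : ∀ x y, cross (f x) (f y) = δ * cross x y) (t : ℂ) :
    ∃ ψ : ℂ ≃ᵃ[ℝ] ℂ, ∀ z, ψ z = f z + t := by
  have hinj : Function.Injective f := by
    refine (injective_iff_map_eq_zero f).2 fun z hz => ?_
    have h0 : ∀ y, cross z y = 0 := by
      intro y
      have := hf z y
      rw [hz, zero_cross] at this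
      exact (mul_eq_zero.1 this.symm).resolve_left hδ.ne'
    have h1 := h0 1
    have h2 := h0 Complex.I
    simp [cross] at h1 h2
    exact Complex.ext h2 h1
  refine ⟨(LinearEquiv.ofInjectiveEndo f hinj).toAffineEquiv.trans (AffineEquiv.constVAdd ℝ ℂ t),
    fun z => ?_⟩
  simp [add_comm]

theorem isAffinelyRegular_of_angle (hm : 3 ≤ m) (hθ : ∀ k : ℤ, θ k = 2 * Real.pi / m * k)
    (hδ : 0 < δ) (hf : ∀ x y, cross (f x) (f y) = δ * cross x y) :
    IsAffinelyRegular (polygonOf m fun k => f (Complex.exp (θ k * Complex.I)) + t) := by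
  have hm0 : (0 : ℝ) < m := by exact_mod_cast (by omega : 0 < m)
  refine ⟨isConvexPolygon_of_angle hm ?_ ?_ hδ hf, ?_⟩
  · intro a b hab
    rw [hθ, hθ]
    have : (a : ℝ) < b := by exact_mod_cast hab
    gcongr
  · intro k
    rw [hθ, hθ]
    push_cast
    field_simp
  · obtain ⟨ψ, hψ⟩ := exists_affineEquiv hδ hf t
    refine ⟨ψ, fun i => ?_⟩
    rw [hψ, polygonOf, hθ, zeta, ← Complex.exp_nat_mul]
    congr 3
    push_cast
    ring

end Circle

theorem exists_directionSet {D : ℕ → ℂ} (hD : ∀ i j, i < j → j < 4 → cross (D i) (D j) ≠ 0) :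
    ∃ U : Finset ℂ, IsDirectionSet U ∧ U.card = 4 ∧ (∀ u ∈ U, ∃ s < 4, u = D s / ‖D s‖) ∧
      ∀ s < 4, D s ≠ 0 ∧ D s / ‖D s‖ ∈ U := by
  have hD' : ∀ i j, i < 4 → j < 4 → i ≠ j → cross (D i) (D j) ≠ 0 := by
    intro i j hi hj hij
    rcases lt_or_gt_of_ne hij with h | h
    · exact hD i j h hj
    · have := hD j i h hi
      intro h0
      apply this
      simp only [cross] at h0 ⊢
      linarith
  have h0 : ∀ s < 4, D s ≠ 0 := by
    intro s hs h
    obtain ⟨j, hj, hjs⟩ : ∃ j < 4, s ≠ j := by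
      rcases eq_or_ne s 0 with rfl | h
      · exact ⟨1, by norm_num, by norm_num⟩
      · exact ⟨0, by norm_num, h⟩
    exact hD' s j hs hj hjs (by rw [h, zero_cross])
  have hn : ∀ s < 4, ((‖D s‖ : ℝ) : ℂ) ≠ 0 := fun s hs => by
    exact_mod_cast norm_ne_zero_iff.2 (h0 s hs)
  have hpar : ∀ i j, i < 4 → j < 4 → i ≠ j → ¬ ∃ r : ℝ, D j / ‖D j‖ = r * (D i / ‖D i‖) := by
    rintro i j hi hj hij ⟨r, h⟩
    apply hD' i j hi hj hij
    have h3 : D j = ((r * ‖D j‖ / ‖D i‖ : ℝ) : ℂ) * D i := by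
      rw [div_eq_iff (hn j hj)] at h
      refine h.trans ?_
      push_cast; ring
    rw [h3, cross_real_mul]
    simp only [cross]; ring
  refine ⟨(Finset.range 4).image fun s => D s / ‖D s‖, ⟨?_, ?_⟩, ?_, ?_, ?_⟩
  · intro u hu
    obtain ⟨s, hs, rfl⟩ := Finset.mem_image.1 hu
    rw [norm_div, Complex.norm_real, norm_norm,
      div_self (norm_ne_zero_iff.2 (h0 s (Finset.mem_range.1 hs)))]
  · intro u hu w hw huw
    obtain ⟨i, hi, rfl⟩ := Finset.mem_image.1 hu
    obtain ⟨j, hj, rfl⟩ := Finset.mem_image.1 hw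
    rintro ⟨r, -, h⟩
    refine hpar i j (Finset.mem_range.1 hi) (Finset.mem_range.1 hj) ?_ ⟨r, h⟩
    rintro rfl
    exact huw rfl
  · rw [Finset.card_image_of_injOn, Finset.card_range]
    intro i hi j hj hij
    by_contra hne
    refine hpar i j (by simpa using hi) (by simpa using hj) hne ⟨1, ?_⟩
    simpa using hij.symm
  · intro u hu
    obtain ⟨s, hs, rfl⟩ := Finset.mem_image.1 hu
    exact ⟨s, Finset.mem_range.1 hs, rfl⟩
  · intro s hs
    exact ⟨h0 s hs, Finset.mem_image.2 ⟨s, Finset.mem_range.2 hs, rfl⟩⟩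

/-- The angles of the union of a regular `N`-gon and of its rotation through `β`. -/
noncomputable def angle (N : ℕ) (β : ℝ) (k : ℤ) : ℝ :=
  2 * Real.pi / N * (k / 2 : ℤ) + β * (k % 2 : ℤ)

/-- The indices have opposite parity, so β enters exactly once. -/
theorem angle_add {N : ℕ} {β : ℝ} {a b s : ℤ} (h : a + b = 2 * s + 1) :
    angle N β a + angle N β b = 2 * (Real.pi / N * s + β / 2) := by
  have h1 : a / 2 + b / 2 = s := by omega
  have h2 : a % 2 + b % 2 = 1 := by omega
  have h1' : ((a / 2 : ℤ) : ℝ) + ((b / 2 : ℤ) : ℝ) = s := by exact_mod_cast h1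
  have h2' : ((a % 2 : ℤ) : ℝ) + ((b % 2 : ℤ) : ℝ) = 1 := by exact_mod_cast h2
  unfold angle
  linear_combination 2 * Real.pi / N * h1' + β * h2'

theorem angle_periodic {N : ℕ} (hN : N ≠ 0) (β : ℝ) (k : ℤ) :
    angle N β (k + (2 * N : ℕ)) = angle N β k + 2 * Real.pi := by
  have h1 : (k + (2 * N : ℕ)) / 2 = k / 2 + N := by omega
  have h2 : (k + (2 * N : ℕ)) % 2 = k % 2 := by omega
  have : (N : ℝ) ≠ 0 := by exact_mod_cast hN
  rw [angle, angle, h1, h2]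
  push_cast
  field_simp
  ring

theorem angle_strictMono {N : ℕ} {β : ℝ} (h1 : 0 < β) (h2 : β < 2 * Real.pi / N) :
    StrictMono (angle N β) := by
  refine strictMono_int_of_lt_succ fun k => ?_
  rcases Int.emod_two_eq_zero_or_one k with h | h
  · have e1 : (k + 1) / 2 = k / 2 := by omega
    have e2 : (k + 1) % 2 = 1 := by omega
    rw [angle, angle, e1, e2, h]
    push_cast
    linarith
  · have e1 : (k + 1) / 2 = k / 2 + 1 := by omega
    have e2 : (k + 1) % 2 = 0 := by omega
    rw [angle, angle, e1, e2, h]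
    push_cast
    linarith

/-- Vertices whose indices add up to 2s + 1 have a fixed sum of angles, so the chords joining them
are parallel; the edge from s to s + 1 is one of them. The values s = 0, 1, 2, 3 provide the four
directions. -/
theorem exists_uPolygon {N : ℕ} (hN : 4 ≤ N) {β : ℝ} (h1 : 0 < β) (h2 : β < 2 * Real.pi / N)
    {f : ℂ →ₗ[ℝ] ℂ} {δ : ℝ} (hδ : 0 < δ) (hf : ∀ x y, cross (f x) (f y) = δ * cross x y) (t : ℂ) :
    ∃ U : Finset ℂ,
      IsUPolygon U (polygonOf (2 * N) fun k => f (Complex.exp (angle N β k * Complex.I)) + t) ∧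
      HasClass U (polygonOf (2 * N) fun k => f (Complex.exp (angle N β k * Complex.I)) + t) 4 ∧
      ∀ u ∈ U, ∃ s : ℕ, s < 4 ∧ u =
        f (Complex.I * Complex.exp ((Real.pi / N * s + β / 2 : ℝ) * Complex.I)) /
        ‖f (Complex.I * Complex.exp ((Real.pi / N * s + β / 2 : ℝ) * Complex.I))‖ := by
  have hN0 : N ≠ 0 := by omega
  have hNR : (4 : ℝ) ≤ N := by exact_mod_cast hN
  have hm0 : 2 * N ≠ 0 := by omega
  have : NeZero (2 * N) := ⟨hm0⟩
  set D : ℕ → ℂ := fun s =>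
    f (Complex.I * Complex.exp ((Real.pi / N * s + β / 2 : ℝ) * Complex.I)) with hD
  have hcross : ∀ i j, i < j → j < 4 → cross (D i) (D j) ≠ 0 := by
    intro i j hij hj
    rw [hD]
    dsimp only
    rw [hf, cross_I_mul_exp]
    refine (mul_pos hδ (Real.sin_pos_of_pos_of_lt_pi ?_ ?_)).ne'
    · have : (i : ℝ) < j := by exact_mod_cast hij
      have h3 : (0 : ℝ) < N := by linarith
      have := mul_lt_mul_of_pos_left this (div_pos Real.pi_pos h3)
      linarith
    · have h3 : (0 : ℝ) < N := by linarith
      have h4 : (j : ℝ) < 4 := by exact_mod_cast hj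
      have h5 : (0 : ℝ) ≤ i := Nat.cast_nonneg i
      have h6 : Real.pi / N * (j - i) < Real.pi / N * N := by
        apply mul_lt_mul_of_pos_left _ (div_pos Real.pi_pos h3)
        linarith
      rw [div_mul_cancel₀ _ h3.ne'] at h6
      linarith
  obtain ⟨U, hU, hcard, hU1, hU2⟩ := exists_directionSet hcross
  have hmono := angle_strictMono h1 h2
  have hper := angle_periodic hN0 β
  have hconv := isConvexPolygon_of_angle (t := t) (by omega) hmono hper hδ hf
  set v := polygonOf (2 * N) fun k => f (Complex.exp (angle N β k * Complex.I)) + t with hv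
  have hval : ∀ k : ℤ, v (k : ZMod (2 * N)) = f (Complex.exp (angle N β k * Complex.I)) + t :=
    polygonOf_intCast hm0 (periodic_of_angle (f := f) (t := t) hper)
  have hchord : ∀ (a b : ℤ) (s : ℕ), a + b = 2 * s + 1 →
      v (b : ZMod (2 * N)) - v (a : ZMod (2 * N)) =
        ((2 * Real.sin ((angle N β b - angle N β a) / 2) : ℝ) : ℂ) * D s := by
    intro a b s hab
    rw [hval, hval, add_sub_add_right_eq_sub, ← map_sub, exp_sub_exp, ← Complex.real_smul,
      map_smul, Complex.real_smul, angle_add hab, mul_div_cancel_left₀ _ two_ne_zero]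
    rfl
  refine ⟨U, ⟨hU, hconv, ?_⟩, ?_, hU1⟩
  · intro i u hu
    obtain ⟨s, hs, rfl⟩ := hU1 u hu
    obtain ⟨a, rfl⟩ : ∃ a : ℤ, (a : ZMod (2 * N)) = i := ⟨i.val, by simp⟩
    refine ⟨((2 * s + 1 - a : ℤ) : ZMod (2 * N)), ?_, ?_⟩
    -- The partner's index has the opposite parity, which is well defined modulo 2N.
    · intro h
      rw [ZMod.intCast_eq_intCast_iff_dvd_sub] at h
      have : (2 : ℤ) ∣ a - (2 * s + 1 - a) := (Dvd.intro (N : ℤ) (by push_cast; ring)).trans h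
      omega
    · have := hchord a (2 * s + 1 - a) s (by ring)
      have hn : ((‖D s‖ : ℝ) : ℂ) ≠ 0 := by exact_mod_cast norm_ne_zero_iff.2 (hU2 s hs).1
      refine ⟨2 * Real.sin ((angle N β (2 * s + 1 - a) - angle N β a) / 2) * ‖D s‖, ?_⟩
      rw [sub_eq_iff_eq_add'] at this
      rw [this]
      push_cast
      field_simp
  · refine ⟨⟨by norm_num, hcard.ge, 0, fun j hj => ?_⟩, fun c hc => hc.2.1.trans hcard.le⟩
    refine ⟨_, (hU2 j hj).2, ?_⟩
    have := hchord j (j + 1) j (by ring)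
    have hn := norm_ne_zero_iff.2 (hU2 j hj).1
    have hn' : ((‖D j‖ : ℝ) : ℂ) ≠ 0 := by exact_mod_cast hn
    have hsin : 0 < Real.sin ((angle N β (j + 1) - angle N β j) / 2) := by
      have e1 := hmono (lt_add_one (j : ℤ))
      have e2 := hmono (show ((j : ℤ) + 1) < j + (2 * N : ℕ) by omega)
      rw [hper] at e2
      exact Real.sin_pos_of_pos_of_lt_pi (by linarith) (by linarith)
    refine ⟨2 * Real.sin ((angle N β (j + 1) - angle N β j) / 2) * ‖D j‖, by positivity, ?_⟩
    push_cast at this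
    rw [zero_add, this]
    push_cast
    field_simp

/-! ### Polygons in cyclotomic model sets -/

/-- The real-linear map of `ℂ` fixing `1` and sending `i` to `c`. -/
noncomputable def shear (c : ℂ) : ℂ →ₗ[ℝ] ℂ where
  toFun z := z.re + z.im * c
  map_add' x y := by simp; ring
  map_smul' r x := by simp; ring

theorem shear_apply (c z : ℂ) : shear c z = z.re + z.im * c := rfl

theorem cross_shear (c x y : ℂ) : cross (shear c x) (shear c y) = c.im * cross x y := by
  simp [cross, shear_apply]; ring

theorem cross_mul_left (c x y : ℂ) : cross (c * x) (c * y) = Complex.normSq c * cross x y := by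
  simp [cross, Complex.normSq_apply]; ring

/-- The shear is chosen to fix 1 and send ζ_N to ζ_n. It is ℝ-linear, hence k_N-linear, and so maps
k_N + k_N ζ_N into k_n + k_n ζ_n. -/
theorem exists_linear_map_K {N n : ℕ} (hN : 3 ≤ N) (hn : 3 ≤ n) (h : k N ≤ k n) :
    ∃ (f : ℂ →ₗ[ℝ] ℂ) (δ : ℝ), 0 < δ ∧ (∀ x y, cross (f x) (f y) = δ * cross x y) ∧
      ∀ z ∈ K N, f z ∈ K n := by
  have hs := zeta_im_pos hN
  have hs' : ((zeta N).im : ℂ) ≠ 0 := by exact_mod_cast hs.ne'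
  set c : ℂ := (zeta n - (zeta N).re) / (zeta N).im with hc
  have hcim : c.im = (zeta n).im / (zeta N).im := by
    rw [hc, Complex.div_ofReal_im]; simp
  refine ⟨shear c, c.im, ?_, cross_shear c, fun z hz => ?_⟩
  · rw [hcim]; exact div_pos (zeta_im_pos hn) hs
  · obtain ⟨a, ha, b, hb, rfl⟩ := exists_eq_add_mul_zeta (by omega) hz
    obtain ⟨x, rfl⟩ := Complex.conj_eq_iff_real.1 (mem_reals.1 (k_le_reals N ha))
    obtain ⟨y, rfl⟩ := Complex.conj_eq_iff_real.1 (mem_reals.1 (k_le_reals N hb))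
    have : shear c (x + y * zeta N) = x + y * zeta n := by
      have h1 : ((zeta N).im : ℂ) * c = zeta n - (zeta N).re := by rw [hc]; field_simp
      rw [shear_apply]
      simp only [Complex.add_re, Complex.ofReal_re, Complex.mul_re, Complex.ofReal_im, zero_mul,
        sub_zero, Complex.add_im, Complex.mul_im, add_zero, zero_add]
      push_cast
      linear_combination (y : ℂ) * h1
    rw [this]
    exact add_mem (k_le_K n (h ha)) (mul_mem (k_le_K n (h hb)) (zeta_mem_K n))

theorem exp_angle (N : ℕ) (β : ℝ) (k : ℤ) : Complex.exp (angle N β k * Complex.I) =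
    zeta N ^ (k / 2) * Complex.exp (β * Complex.I) ^ (k % 2) := by
  rw [zeta_eq_exp, ← Complex.exp_int_mul, ← Complex.exp_int_mul, ← Complex.exp_add, angle]
  congr 1
  push_cast
  ring

/-- `K_N` contains points of the unit circle on the arc from `1` to `ζ_N`. -/
theorem exists_angle_mem_K {N : ℕ} (hN : 3 ≤ N) : ∃ β : ℝ, 0 < β ∧ β < 2 * Real.pi / N ∧
    Complex.exp (β * Complex.I) ∈ K N := by
  have hNR : (3 : ℝ) ≤ N := by exact_mod_cast hN
  have hN0 : (0 : ℝ) < N := by linarith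
  -- The weight 2 puts z on the side of 1, with argument strictly between 0 and π/N. Doubling the
  -- argument gives z / conj z, which lies in K_N even if z / ‖z‖ does not.
  set z : ℂ := 2 + zeta N with hz
  have him : 0 < z.im := by simpa [hz] using zeta_im_pos hN
  have hz0 : z ≠ 0 := by rintro h; simp [h] at him
  have hnorm : 0 < ‖z‖ := norm_pos_iff.2 hz0
  have hpolar : (‖z‖ : ℂ) * Complex.exp (z.arg * Complex.I) = z := Complex.norm_mul_exp_arg_mul_I z
  have hpos : 0 < z.arg := by
    refine lt_of_le_of_ne (Complex.arg_nonneg_iff.2 him.le) fun h => ?_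
    have := Complex.arg_eq_zero_iff.1 h.symm
    linarith [this.2]
  have hlt : z.arg < Real.pi / N := by
    by_contra hge
    rw [not_lt] at hge
    have h1 : 0 ≤ Real.sin (z.arg - Real.pi / N) := by
      refine Real.sin_nonneg_of_nonneg_of_le_pi (by linarith) ?_
      have := Complex.arg_le_pi z
      have := div_pos Real.pi_pos hN0
      linarith
    have h2 : ‖z‖ * Real.sin (z.arg - Real.pi / N) = -Real.sin (Real.pi / N) := by
      have hre : z.re = 2 + Real.cos (2 * Real.pi / N) := by simp [hz, zeta_re]
      have him' : z.im = Real.sin (2 * Real.pi / N) := by simp [hz, zeta_im]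
      have e1 : ‖z‖ * Real.cos z.arg = z.re := Complex.norm_mul_cos_arg z
      have e2 : ‖z‖ * Real.sin z.arg = z.im := Complex.norm_mul_sin_arg z
      have e3 : 2 * Real.pi / N = 2 * (Real.pi / N) := by ring
      rw [hre, e3, Real.cos_two_mul] at e1
      rw [him', e3, Real.sin_two_mul] at e2
      rw [Real.sin_sub]
      linear_combination Real.cos (Real.pi / N) * e2 - Real.sin (Real.pi / N) * e1
    have h3 : 0 < Real.sin (Real.pi / N) := by
      refine Real.sin_pos_of_pos_of_lt_pi (by positivity) ?_
      rw [div_lt_iff₀ hN0]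
      nlinarith [Real.pi_pos]
    nlinarith
  refine ⟨2 * z.arg, by linarith, by rw [mul_div_assoc]; linarith, ?_⟩
  have hzK : z ∈ K N := add_mem (ofNat_mem (K N) 2) (zeta_mem_K N)
  have hexp : Complex.exp ((2 * z.arg : ℝ) * Complex.I) = z / conj z := by
    have hc0 : conj z ≠ 0 := (map_ne_zero _).2 hz0
    have hn0 : (‖z‖ : ℂ) ≠ 0 := by exact_mod_cast hnorm.ne'
    have e1 : conj z = ‖z‖ * Complex.exp (-(z.arg * Complex.I)) := by
      conv_lhs => rw [← hpolar]
      rw [map_mul, Complex.conj_ofReal, ← Complex.exp_conj]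
      simp
    rw [eq_div_iff hc0, e1]
    conv_rhs => rw [← hpolar]
    rw [mul_left_comm, ← Complex.exp_add]
    congr 2
    push_cast
    ring
  rw [hexp]
  exact div_mem hzK (conj_mem_K hzK)

theorem IsCyclotomicModelSet.exists_scaled {n : ℕ} (hn : 3 ≤ n) {Λ : Set ℂ}
    (hΛ : IsCyclotomicModelSet n Λ) {m : ℕ} (hm : m ≠ 0) {θ : ℤ → ℝ} {f : ℂ →ₗ[ℝ] ℂ} {δ : ℝ}
    (hδ : 0 < δ) (hf : ∀ x y, cross (f x) (f y) = δ * cross x y)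
    (hK : ∀ k, f (Complex.exp (θ k * Complex.I)) ∈ K n) :
    ∃ (f' : ℂ →ₗ[ℝ] ℂ) (δ' : ℝ) (t : ℂ), 0 < δ' ∧
      (∀ x y, cross (f' x) (f' y) = δ' * cross x y) ∧
      ∀ i, polygonOf m (fun k => f' (Complex.exp (θ k * Complex.I)) + t) i ∈ Λ := by
  have : NeZero m := ⟨hm⟩
  obtain ⟨r, hr, t, h⟩ := hΛ.exists_homothety hn
    (fun i : ZMod m => f (Complex.exp (θ i.val * Complex.I))) fun i => hK _
  refine ⟨r • f, r * (r * δ), t, by positivity, fun x y => ?_, fun i => ?_⟩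
  · rw [LinearMap.smul_apply, LinearMap.smul_apply, Complex.real_smul, Complex.real_smul,
      real_mul_cross, cross_real_mul, hf]
    ring
  · rw [polygonOf, LinearMap.smul_apply, Complex.real_smul]
    exact h i

theorem IsCyclotomicModelSet.exists_uPolygon {N n : ℕ} (hN : 4 ≤ N) (hn : 3 ≤ n) {Λ : Set ℂ}
    (hΛ : IsCyclotomicModelSet n Λ) (h : k N ≤ k n) :
    ∃ (U : Finset ℂ) (v : ZMod (2 * N) → ℂ), PolygonIn Λ v ∧ IsUPolygon U v ∧ HasClass U v 4 := by
  obtain ⟨f, δ, hδ, hf, hfK⟩ := exists_linear_map_K (by omega) hn h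
  obtain ⟨β, h1, h2, hβ⟩ := exists_angle_mem_K (N := N) (by omega)
  obtain ⟨f', δ', t, hδ', hf', hmem⟩ := hΛ.exists_scaled hn (m := 2 * N) (by omega)
    (θ := angle N β) hδ hf fun k => hfK _ (by
      rw [exp_angle]; exact mul_mem (zpow_mem (zeta_mem_K N) _) (zpow_mem hβ _))
  obtain ⟨U, hU, hc, -⟩ := UPoly.exists_uPolygon hN h1 h2 hδ' hf' t
  exact ⟨U, _, ⟨hU.2.1, hmem⟩, hU, hc⟩

theorem IsCyclotomicModelSet.exists_affinelyRegular {L n : ℕ} (hL : 3 ≤ L) (hn : 3 ≤ n)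
    {Λ : Set ℂ} (hΛ : IsCyclotomicModelSet n Λ) (h : k L ≤ k n) :
    ∃ v : ZMod L → ℂ, IsAffinelyRegular v ∧ PolygonIn Λ v := by
  obtain ⟨f, δ, hδ, hf, hfK⟩ := exists_linear_map_K hL hn h
  obtain ⟨f', δ', t, hδ', hf', hmem⟩ := hΛ.exists_scaled hn (m := L) (by omega)
    (θ := fun k => 2 * Real.pi / L * k) hδ hf fun k => hfK _ (by
      have : ((2 * Real.pi / L * k : ℝ) : ℂ) * Complex.I =
          k * (((2 * Real.pi / L : ℝ) : ℂ) * Complex.I) := by push_cast; ring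
      rw [this, Complex.exp_int_mul, ← zeta_eq_exp]
      exact zpow_mem (zeta_mem_K L) k)
  have := isAffinelyRegular_of_angle (t := t) hL (fun k => rfl) hδ' hf'
  exact ⟨_, this, this.1, hmem⟩

theorem IsCyclotomicModelSet.isLambdaDirection {n : ℕ} (hn : 3 ≤ n) {Λ : Set ℂ}
    (hΛ : IsCyclotomicModelSet n Λ) {u : ℂ} (hu : ‖u‖ = 1) {r : ℝ} (hr : r ≠ 0)
    (h : (r : ℂ) * u ∈ K n) : IsLambdaDirection Λ u := by
  obtain ⟨s, hs, t, hst⟩ := hΛ.exists_homothety hn (![0, r * u] : Fin 2 → ℂ) (by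
    intro i
    fin_cases i
    · exact zero_mem _
    · exact h)
  have h0 := hst 0
  have h1 := hst 1
  simp only [Matrix.cons_val_zero, Matrix.cons_val_one, mul_zero, zero_add] at h0 h1
  have hu0 : u ≠ 0 := by rintro rfl; simp at hu
  refine ⟨hu, s * (r * u), ⟨_, h1, _, h0, by simp⟩, ?_, s * r, mul_ne_zero hs.ne' hr, ?_⟩
  · exact mul_ne_zero (by exact_mod_cast hs.ne') (mul_ne_zero (by exact_mod_cast hr) hu0)
  · push_cast; ring

theorem one_add_zeta {N : ℕ} : 1 + zeta N =
    ((2 * Real.cos (Real.pi / N) : ℝ) : ℂ) * Complex.exp ((Real.pi / N : ℝ) * Complex.I) := by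
  have h : zeta N = Complex.exp ((Real.pi / N : ℝ) * Complex.I) *
      Complex.exp ((Real.pi / N : ℝ) * Complex.I) := by
    rw [zeta_eq_exp, ← Complex.exp_add]; congr 1; push_cast; ring
  rw [h]
  push_cast
  rw [Complex.two_cos, add_mul, ← Complex.exp_add, neg_mul, ← Complex.exp_add, neg_add_cancel,
    Complex.exp_zero, add_comm]

/-- With β = π/N the polygon is a regular 2N-gon before f is applied. Its edge directions, turned by
ρ, are e^{iπs/N}; these need not lie in K_N, but their positive multiples (1 + ζ_N)^s do. -/
theorem IsCyclotomicModelSet.exists_affinelyRegular_uPolygon {N n : ℕ} (hN : 4 ≤ N) (hn : 3 ≤ n)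
    {Λ : Set ℂ} (hΛ : IsCyclotomicModelSet n Λ) (h : k N ≤ k n) :
    ∃ (U : Finset ℂ) (v : ZMod (2 * N) → ℂ), (∀ u ∈ U, IsLambdaDirection Λ u) ∧
      IsAffinelyRegular v ∧ IsUPolygon U v ∧ HasClass U v 4 := by
  obtain ⟨f, δ, hδ, hf, hfK⟩ := exists_linear_map_K (by omega) hn h
  have hNR : (4 : ℝ) ≤ N := by exact_mod_cast hN
  have hN0 : (0 : ℝ) < N := by linarith
  set φ : ℝ := Real.pi / N with hφ
  have hφ0 : 0 < φ := div_pos Real.pi_pos hN0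
  have hφ1 : φ < Real.pi / 2 := by
    rw [hφ]
    exact div_lt_div_of_pos_left Real.pi_pos (by norm_num) (by linarith)
  set ρ : ℂ := (Complex.I * Complex.exp ((φ / 2 : ℝ) * Complex.I))⁻¹ with hρ
  have hρ0 : ρ ≠ 0 := inv_ne_zero (mul_ne_zero Complex.I_ne_zero (Complex.exp_ne_zero _))
  set g : ℂ →ₗ[ℝ] ℂ := f.comp (LinearMap.mulLeft ℝ ρ) with hg
  have hgf : ∀ z, g z = f (ρ * z) := fun z => rfl
  have hgδ : ∀ x y, cross (g x) (g y) = δ * Complex.normSq ρ * cross x y := by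
    intro x y
    rw [hgf, hgf, hf, cross_mul_left]; ring
  have hδ' : 0 < δ * Complex.normSq ρ := mul_pos hδ (Complex.normSq_pos.2 hρ0)
  obtain ⟨U, hU, hc, hdir⟩ := UPoly.exists_uPolygon hN (β := φ) hφ0
    (by rw [mul_div_assoc]; linarith) hδ' hgδ 0
  refine ⟨U, _, fun u hu => ?_, ?_, hU, hc⟩
  · have hu1 := hU.1.1 u hu
    obtain ⟨s, -, hus⟩ := hdir u hu
    set D : ℂ := g (Complex.I * Complex.exp ((Real.pi / N * s + φ / 2 : ℝ) * Complex.I)) with hD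
    have hD0 : D ≠ 0 := by rintro h0; rw [hus, h0] at hu1; simp at hu1
    have hDn : ‖D‖ ≠ 0 := norm_ne_zero_iff.2 hD0
    have hDf : D = f (Complex.exp ((φ : ℝ) * Complex.I) ^ s) := by
      rw [hD, hgf]
      congr 1
      rw [hρ, inv_mul_eq_iff_eq_mul₀ (fun h0 => hρ0 (by rw [hρ, h0, inv_zero])), mul_assoc, ← Complex.exp_nat_mul,
        ← Complex.exp_add]
      congr 2
      rw [hφ]
      push_cast
      ring
    have hcos : (2 * Real.cos φ) ^ s ≠ 0 :=
      pow_ne_zero _ (mul_pos two_pos (Real.cos_pos_of_mem_Ioo ⟨by linarith, hφ1⟩)).ne'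
    refine hΛ.isLambdaDirection hn hu1 (r := (2 * Real.cos φ) ^ s * ‖D‖) (mul_ne_zero hcos hDn) ?_
    have : (((2 * Real.cos φ) ^ s * ‖D‖ : ℝ) : ℂ) * u = f ((1 + zeta N) ^ s) := by
      have hDn' : (‖D‖ : ℂ) ≠ 0 := by exact_mod_cast hDn
      have h1 : (1 + zeta N) ^ s =
          (((2 * Real.cos φ) ^ s : ℝ) : ℂ) * Complex.exp ((φ : ℝ) * Complex.I) ^ s := by
        rw [one_add_zeta, mul_pow, Complex.ofReal_pow]
      rw [h1, ← Complex.real_smul (x := (2 * Real.cos φ) ^ s)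
        (z := Complex.exp ((φ : ℝ) * Complex.I) ^ s), map_smul, Complex.real_smul, ← hDf, hus,
        Complex.ofReal_mul, mul_assoc, mul_div_cancel₀ _ hDn']
    rw [this]
    exact hfK _ (pow_mem (add_mem (one_mem _) (zeta_mem_K N)) s)
  · refine isAffinelyRegular_of_angle (by omega) (fun k => ?_) hδ' hgδ
    have h1 : ((k / 2 : ℤ) : ℝ) * 2 + ((k % 2 : ℤ) : ℝ) = k := by
      exact_mod_cast Int.ediv_mul_add_emod k 2
    rw [angle, ← h1, hφ]
    push_cast
    field_simp

theorem HasClass.hasConsecutive_four {m : ℕ} {U : Finset ℂ} {v : ZMod m → ℂ} {c : ℕ}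
    (h : HasClass U v c) (hc : 4 ≤ c) : HasConsecutive U v 4 := by
  obtain ⟨i, hi⟩ := h.1.2.2
  exact ⟨i, fun j hj => hi j (hj.trans_le hc)⟩

/-- For odd N the fields K_{2N} and K_N coincide, as −1 lies in both. -/
theorem k_lcm_two_le {N : ℕ} (hN : 3 ≤ N) : k (N.lcm 2) ≤ k N := by
  rcases Nat.even_or_odd N with he | ho
  · rw [Nat.lcm_eq_left he.two_dvd]
  · rw [Nat.Coprime.lcm_eq_mul ho.coprime_two_right, mul_comm]
    refine k_le_of_K_le hN (K_le_iff.2 ?_)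
    rw [zeta_two_mul_odd ho]
    exact neg_mem (pow_mem (zeta_mem_K N) _)

end UPoly

theorem corollary4p1 (m n : ℕ) (hm : 8 ≤ m) (hm_even : Even m) (hn : 3 ≤ n)
    (Λ : Set ℂ) (hΛ : UPoly.IsCyclotomicModelSet n Λ) :
    List.TFAE [
      ∃ (U : Finset ℂ) (v : ZMod m → ℂ) (c : ℕ), 4 ≤ c ∧
        UPoly.PolygonIn Λ v ∧ UPoly.IsUPolygon U v ∧ UPoly.HasClass U v c,
      ∃ (U : Finset ℂ) (v : ZMod m → ℂ) (c : ℕ), 4 ≤ c ∧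
        (∀ u ∈ U, UPoly.IsLambdaDirection Λ u) ∧ UPoly.IsAffinelyRegular v ∧
        UPoly.IsUPolygon U v ∧ UPoly.HasClass U v c,
      UPoly.k (m / 2) ≤ UPoly.kSet Λ,
      ∃ v : ZMod (Nat.lcm (m / 2) 2) → ℂ, UPoly.IsAffinelyRegular v ∧ UPoly.PolygonIn Λ v,
      UPoly.k (m / 2) ≤ UPoly.k n,
      (m = 8 ∨ m = 12) ∨ UPoly.K (m / 2) ≤ UPoly.K n,
      (m = 8 ∨ m = 12) ∨ m ∣ 2 * n ∨ (∃ d : ℕ, Odd d ∧ d ∣ n ∧ m = 4 * d),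
      (m = 8 ∨ m = 12) ∨ UPoly.O (m / 2) ≤ UPoly.O n,
      UPoly.o (m / 2) ≤ UPoly.o n] := by
  tfae_have 1 → 3 := by
    rintro ⟨U, v, c, hc, hP, hU, hcl⟩
    exact UPoly.k_le_kSet_of_isUPolygon hm hm_even hP.2 hU (hcl.hasConsecutive_four hc)
  tfae_have 2 → 3 := by
    rintro ⟨U, v, c, hc, hdir, hreg, -, hcl⟩
    exact UPoly.k_le_kSet_of_directions hm hm_even hdir hreg (hcl.hasConsecutive_four hc)
  tfae_have 4 → 3 := by
    rintro ⟨v, hreg, hP⟩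
    exact (UPoly.k_le_of_dvd (Nat.lcm_ne_zero (by omega) two_ne_zero)
      (Nat.dvd_lcm_left _ _)).trans (UPoly.k_le_kSet_of_isAffinelyRegular hreg hP.2)
  tfae_have 3 ↔ 5 := by rw [hΛ.kSet_eq hn]
  obtain ⟨N, rfl⟩ := hm_even.two_dvd
  have hN : 4 ≤ N := by omega
  have hN0 : N ≠ 0 := by omega
  have hn0 : n ≠ 0 := by omega
  -- The exceptional m correspond to N = 4 and N = 6, for which ζ_N has rational trace.
  have hcases : (2 * N = 8 ∨ 2 * N = 12) ↔ (N = 4 ∨ N = 6) := by omega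
  rw [Nat.mul_div_cancel_left N two_pos, hcases] at *
  tfae_have 5 → 1 := by
    intro h
    obtain ⟨U, v, hv, hU, hc⟩ := hΛ.exists_uPolygon hN hn h
    exact ⟨U, v, 4, le_rfl, hv, hU, hc⟩
  tfae_have 5 → 2 := by
    intro h
    obtain ⟨U, v, hdir, hreg, hU, hc⟩ := hΛ.exists_affinelyRegular_uPolygon hN hn h
    exact ⟨U, v, 4, le_rfl, hdir, hreg, hU, hc⟩
  tfae_have 5 → 4 := by
    intro h
    refine hΛ.exists_affinelyRegular ?_ hn ((UPoly.k_lcm_two_le (by omega)).trans h)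
    exact le_trans (by omega)
      (Nat.le_of_dvd (Nat.lcm_pos (by omega) two_pos) (Nat.dvd_lcm_left N 2))
  tfae_have 5 → 6 := UPoly.K_le_of_k_le hN hn0
  tfae_have 6 ↔ 7 := by
    rw [UPoly.K_le_iff, UPoly.zeta_mem_K_iff hN0 hn0, Nat.mul_dvd_mul_iff_left two_pos]
    refine or_congr_right (or_congr_right (exists_congr fun d => ?_))
    rw [show 2 * N = 4 * d ↔ N = 2 * d by omega]
  tfae_have 6 ↔ 8 := by rw [UPoly.O_le_iff hN0 hn0]
  tfae_have 6 → 9 := by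
    rintro (h | h)
    · exact UPoly.o_le_of_eq h
    · exact UPoly.o_le_of_K_le hN0 hn0 h
  tfae_have 9 → 5 := UPoly.k_le_of_o_le
  tfae_finish
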